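/- Let $d\ge 1$, $0<\alpha<1$, $1<p<q<\infty$ with $1-\alpha+\frac1q=\frac1p$. A dyadic interval is an interval $[j2^k,(j+1)2^k)$ with $j,k\in\mathbb Z$; for such an $I$, with left and right halves $I_-,I_+$, put $h_I=|I|^{-1/2}(-\mathbf 1_{I_-}+\mathbf 1_{I_+})$. A dyadic rectangle in $\mathbb R^d$ is a product $R=R_1\times\cdots\times R_d$ of dyadic intervals, and $h_R(x)=\prod_{j=1}^d h_{R_j}(x_j)$. Let $\operatorname I_{\alpha,j}$ be the one-variable dyadic Riesz potential $$\operatorname I_\alpha f=\sum_{I\ \text{dyadic}}\frac{\langle f,\mathbf 1_I\rangle}{|I|^{\alpha}}\,\mathbf 1_I$$ applied in the $j$-th coordinate of functions on $\mathbb R^d$, let $\operatorname M_bf=bf$, and let $[\operatorname A,\operatorname B]=\operatorname A\operatorname B-\operatorname B\operatorname A$. Then there is a constant $c>0$, depending only on $d,\alpha,p,q$, such that for every locally integrable (real- or complex-valued) function $b$ on $\mathbb R^d$, $$\bigl\|[\cdots[\operatorname M_b,\operatorname I_{\alpha,1}],\cdots,\operatorname I_{\alpha,d}]\bigr\|_{L^p\to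 L^q}\;\ge\; c\,\sup_{S}\Bigl[|S|^{-1}\sum_{R\subset S}|\langle b,h_R\rangle|^2\Bigr]^{1/2},$$ where $S$ and $R$ range over dyadic rectangles and $\langle b,h_R\rangle=\int_{\mathbb R^d} b\,h_R$. Here the norm on the left is the supremum of the $L^q$ norms of the iterated commutator applied to bounded measurable functions $f$ with compact support and $\|f\|_{L^p}\le 1$; both sides may be $+\infty$. -/

import Mathlib

open MeasureTheory Set
open scoped ENNReal NNReal

noncomputable section

namespace DyadicRiesz

/-- The pair `(k, j)` is the index of the dyadic interval `[j 2^k, (j+1) 2^k)`; distinct pairs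
index distinct intervals, so sums over `ℤ × ℤ` are sums over all dyadic intervals. -/
abbrev DyadicInterval : Type := ℤ × ℤ

namespace DyadicInterval

/-- The length `2^k`. -/
def length (I : DyadicInterval) : ℝ := (2 : ℝ) ^ I.1

/-- The interval `[j 2^k, (j+1) 2^k)` as a set of reals. -/
def carrier (I : DyadicInterval) : Set ℝ :=
  Ico ((I.2 : ℝ) * I.length) (((I.2 : ℝ) + 1) * I.length)

/-- The left half of `I`. -/
def left (I : DyadicInterval) : DyadicInterval := (I.1 - 1, 2 * I.2)

/-- The right half of `I`. -/
def right (I : DyadicInterval) : DyadicInterval := (I.1 - 1, 2 * I.2 + 1)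

/-- The Haar function `h_I = |I|^{-1/2} (-1_{I_-} + 1_{I_+})`. -/
def haar (I : DyadicInterval) (t : ℝ) : ℝ :=
  I.length ^ (-(1 / 2 : ℝ)) *
    (-(I.left.carrier.indicator 1 t) + I.right.carrier.indicator 1 t)

end DyadicInterval

/-- Dyadic rectangles in `ℝ^d`: products of `d` dyadic intervals. -/
abbrev DyadicRectangle (d : ℕ) : Type := Fin d → DyadicInterval

namespace DyadicRectangle

variable {d : ℕ}

/-- The product set of the sides. -/
def carrier (R : DyadicRectangle d) : Set (Fin d → ℝ) :=
  Set.pi univ fun j => (R j).carrier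

/-- The tensor product Haar function `h_R(x) = ∏ j, h_{R_j}(x_j)`. -/
def haar (R : DyadicRectangle d) (x : Fin d → ℝ) : ℝ :=
  ∏ j, (R j).haar (x j)

end DyadicRectangle

variable {𝕜 : Type*} [RCLike 𝕜] {d : ℕ}

/-- The Haar coefficient `⟨b, h_R⟩`. -/
def haarCoeff (b : (Fin d → ℝ) → 𝕜) (R : DyadicRectangle d) : 𝕜 :=
  ∫ x, R.haar x • b x

/-- The rectangular BMO norm
`sup_S (|S|^{-1} ∑_{R ⊆ S} |⟨b, h_R⟩|^2)^{1/2}`, over all dyadic rectangles `S`. -/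
def rectBMO (b : (Fin d → ℝ) → 𝕜) : ℝ≥0∞ :=
  ⨆ S : DyadicRectangle d,
    ((volume S.carrier)⁻¹ *
      ∑' R : {R : DyadicRectangle d // R.carrier ⊆ S.carrier},
        ‖haarCoeff b (R : DyadicRectangle d)‖ₑ ^ 2) ^ (1 / 2 : ℝ)

/-- The dyadic Riesz potential
`I_α f = ∑_I |I|^{-α} ⟨f, 1_I⟩ 1_I` applied in the `j`-th coordinate of `ℝ^d`. -/
def potential (α : ℝ) (j : Fin d) (f : (Fin d → ℝ) → 𝕜) (x : Fin d → ℝ) : 𝕜 :=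
  ∑' I : DyadicInterval,
    I.carrier.indicator
      (fun _ => I.length ^ (-α) • ∫ t in I.carrier, f (Function.update x j t)) (x j)

/-- Pointwise multiplication by `b`. -/
def mulOp (b f : (Fin d → ℝ) → 𝕜) : (Fin d → ℝ) → 𝕜 := fun x => b x * f x

/-- The commutator `[A, B] = A B - B A`. -/
def comm (A B : ((Fin d → ℝ) → 𝕜) → ((Fin d → ℝ) → 𝕜)) :
    ((Fin d → ℝ) → 𝕜) → ((Fin d → ℝ) → 𝕜) :=
  fun f => A (B f) - B (A f)

/-- The iterated commutator `[⋯[[M_b, I_{α,1}], I_{α,2}], ⋯, I_{α,d}]`. -/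
def iteratedComm (α : ℝ) (b : (Fin d → ℝ) → 𝕜) :
    ((Fin d → ℝ) → 𝕜) → ((Fin d → ℝ) → 𝕜) :=
  (List.finRange d).foldl (fun T j => comm T (potential α j)) (mulOp b)

/-- Bounded measurable functions with compact support. On these the iterated commutator with a
locally integrable symbol is given almost everywhere by absolutely convergent expressions, and
they are dense in `L^p` for `p < ∞`. -/
def IsTest (f : (Fin d → ℝ) → 𝕜) : Prop :=
  Measurable f ∧ (∃ M : ℝ, ∀ x, ‖f x‖ ≤ M) ∧ HasCompactSupport f

/-- The `L^p → L^q` norm of an operator given on bounded measurable functions with compact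
support; it is `∞` if the operator does not extend boundedly. -/
def opNorm (p q : ℝ≥0∞) (T : ((Fin d → ℝ) → 𝕜) → ((Fin d → ℝ) → 𝕜)) : ℝ≥0∞ :=
  ⨆ (f : (Fin d → ℝ) → 𝕜) (_ : IsTest f) (_ : eLpNorm f p volume ≤ 1),
    eLpNorm (T f) q volume

end DyadicRiesz

end

/-! The commutator is tested on functions living on `S` and on the rectangle `S'` whose sides are
the dyadic siblings of the sides of `S`. If `t` and `x` lie in sibling intervals, the dyadic
intervals containing both are exactly the parent and its ancestors, so the kernel of the
one-variable potential is a convergent geometric series with a value that depends only on the common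
length. Between `S` and `S'` each potential is therefore a constant times integration over a side
(`foldComm_potential_eq`).

Expanding the iterated commutator in a pairing `∫ g · [⋯] f` moves some of these integrations onto
`g` and leaves the others on `f`. If one of the two functions is a finite Haar sum with rectangles
inside `S`, it has integral zero in every coordinate and all terms but one disappear. With a
constant on `S'` as the other function, the surviving term is, up to sign, an explicit power of
`|S|` times `∫ b · haarSum` (`integral_mul_foldComm_of_cancel_left`,
`integral_mul_foldComm_of_cancel_right`). Conjugated Haar coefficients of `b` as coefficients turn
this into `σ = ∑ |⟨b, h_R⟩|²`.

Hölder bounds the pairing from above by the operator norm. Only the `L²` norm of a Haar sum is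
computed, by orthonormality. For `q ≥ 2` the Haar sum is `g`, and `L^q` controls `L²` on `S`; for `q
< 2` also `p < 2`, the Haar sum is `f`, and `L²` controls `L^p` on `S`. The relation between `α, p,
q` makes the powers of `|S|` combine to `|S|^{1/2}`, and `c = (2^{-α} / (1 - 2^{-α}))^d` works. -/

noncomputable section

namespace DyadicRiesz

/-! ### Dyadic intervals and the one-variable Haar system. -/

namespace DyadicInterval

theorem length_pos (I : DyadicInterval) : 0 < I.length := zpow_pos two_pos _

theorem length_succ (k m n : ℤ) : length (k + 1, m) = 2 * length (k, n) := by
  simp only [length]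
  rw [zpow_add₀ two_ne_zero, zpow_one, mul_comm]

theorem measurableSet_carrier (I : DyadicInterval) : MeasurableSet I.carrier := measurableSet_Ico

theorem volume_carrier (I : DyadicInterval) : volume I.carrier = ENNReal.ofReal I.length := by
  rw [carrier, Real.volume_Ico]
  congr 1
  ring

theorem volume_real_carrier (I : DyadicInterval) : volume.real I.carrier = I.length := by
  rw [Measure.real, volume_carrier, ENNReal.toReal_ofReal I.length_pos.le]

theorem mem_carrier_iff {I : DyadicInterval} {x : ℝ} :
    x ∈ I.carrier ↔ ⌊x / I.length⌋ = I.2 := by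
  rw [Int.floor_eq_iff, le_div_iff₀ I.length_pos, div_lt_iff₀ I.length_pos]
  rfl

theorem carrier_nonempty (I : DyadicInterval) : I.carrier.Nonempty := by
  refine ⟨I.2 * I.length, ?_⟩
  rw [mem_carrier_iff, mul_div_cancel_right₀ _ I.length_pos.ne', Int.floor_intCast]

theorem eq_of_mem {k m n : ℤ} {x : ℝ} (hm : x ∈ carrier (k, m)) (hn : x ∈ carrier (k, n)) :
    m = n :=
  (mem_carrier_iff.1 hm).symm.trans (mem_carrier_iff.1 hn)

theorem carrier_subset_succ (k m : ℤ) : carrier (k, m) ⊆ carrier (k + 1, m / 2) := by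
  intro x hx
  have hL := length_pos (k, m)
  simp only [carrier, mem_Ico, length_succ k (m / 2) m] at hx ⊢
  have h1 : m / 2 * 2 ≤ m := by omega
  have h2 : m + 1 ≤ (m / 2 + 1) * 2 := by omega
  have h1' : ((m / 2 : ℤ) : ℝ) * 2 ≤ m := by exact_mod_cast h1
  have h2' : (m : ℝ) + 1 ≤ (((m / 2 : ℤ) : ℝ) + 1) * 2 := by exact_mod_cast h2
  constructor
  · nlinarith [mul_le_mul_of_nonneg_right h1' hL.le]
  · nlinarith [mul_le_mul_of_nonneg_right h2' hL.le]

theorem exists_carrier_subset (r : ℕ) (k m : ℤ) :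
    ∃ n, carrier (k, m) ⊆ carrier (k + r, n) := by
  induction r with
  | zero => exact ⟨m, by simp⟩
  | succ r ih =>
    obtain ⟨n, hn⟩ := ih
    refine ⟨n / 2, hn.trans ?_⟩
    have := carrier_subset_succ (k + r) n
    rwa [add_assoc] at this

/-- The ancestor of `I` at the scale of `J` contains `x`, and so does `J`; intervals of one scale
are disjoint, so the two coincide. -/
theorem carrier_subset_of_mem {I J : DyadicInterval} {x : ℝ} (h : I.1 ≤ J.1)
    (hI : x ∈ I.carrier) (hJ : x ∈ J.carrier) : I.carrier ⊆ J.carrier := by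
  obtain ⟨k, m⟩ := I
  obtain ⟨k', m'⟩ := J
  obtain ⟨r, hr⟩ := Int.le.dest h
  simp only at hr
  subst hr
  obtain ⟨n, hn⟩ := exists_carrier_subset r k m
  rwa [eq_of_mem hJ (hn hI)]

theorem left_union_right (I : DyadicInterval) :
    I.left.carrier ∪ I.right.carrier = I.carrier := by
  obtain ⟨k, m⟩ := I
  have h : length (k, m) = 2 * length (k - 1, m) := by
    have := length_succ (k - 1) m m
    rwa [sub_add_cancel] at this
  have e1 : length (left (k, m)) = length (k - 1, m) := rfl
  have e2 : length (right (k, m)) = length (k - 1, m) := rfl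
  have hL := length_pos (k - 1, m)
  rw [carrier, carrier, carrier, e1, e2, h]
  simp only [left, right]
  push_cast
  rw [Ico_union_Ico_eq_Ico]
  · congr 1 <;> ring
  · gcongr; linarith
  · nlinarith

theorem disjoint_left_right (I : DyadicInterval) :
    Disjoint I.left.carrier I.right.carrier := by
  rw [Set.disjoint_left]
  intro x h1 h2
  have := eq_of_mem h1 h2
  omega

theorem haar_eq_zero {I : DyadicInterval} {t : ℝ} (h : t ∉ I.carrier) : I.haar t = 0 := by
  rw [← left_union_right, mem_union, not_or] at h
  simp [haar, h.1, h.2]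

theorem measurable_haar (I : DyadicInterval) : Measurable I.haar := by
  unfold haar
  have h1 := measurableSet_carrier I.left
  have h2 := measurableSet_carrier I.right
  exact (((measurable_const.indicator h1).neg).add (measurable_const.indicator h2)).const_mul _

theorem norm_haar_le (I : DyadicInterval) (t : ℝ) :
    ‖I.haar t‖ ≤ I.length ^ (-(1 / 2 : ℝ)) * 2 := by
  have := Real.rpow_nonneg I.length_pos.le (-(1 / 2 : ℝ))
  rw [haar, norm_mul, Real.norm_of_nonneg this]
  gcongr
  by_cases h1 : t ∈ I.left.carrier <;> by_cases h2 : t ∈ I.right.carrier <;>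
    simp [h1, h2]

theorem integrable_haar (I : DyadicInterval) : Integrable I.haar := by
  have h : I.haar = I.carrier.indicator I.haar := by
    ext t
    by_cases ht : t ∈ I.carrier <;> simp [ht, haar_eq_zero]
  rw [h, integrable_indicator_iff I.measurableSet_carrier]
  refine Measure.integrableOn_of_bounded (M := I.length ^ (-(1 / 2 : ℝ)) * 2) ?_
    I.measurable_haar.aestronglyMeasurable (.of_forall I.norm_haar_le)
  rw [volume_carrier]
  exact ENNReal.ofReal_ne_top

theorem integral_haar (I : DyadicInterval) : ∫ t, I.haar t = 0 := by
  have h1 := measurableSet_carrier I.left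
  have h2 := measurableSet_carrier I.right
  have i1 : Integrable (I.left.carrier.indicator (1 : ℝ → ℝ)) := by
    rw [integrable_indicator_iff h1]
    simp [Pi.one_def, integrableOn_const_iff, volume_carrier]
  have i2 : Integrable (I.right.carrier.indicator (1 : ℝ → ℝ)) := by
    rw [integrable_indicator_iff h2]
    simp [Pi.one_def, integrableOn_const_iff, volume_carrier]
  simp only [haar]
  have e : ∫ t, (-(I.left.carrier.indicator (1 : ℝ → ℝ) t) + I.right.carrier.indicator 1 t) =
      -(∫ t, I.left.carrier.indicator (1 : ℝ → ℝ) t) + ∫ t, I.right.carrier.indicator 1 t := by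
    rw [← integral_neg]
    exact integral_add i1.neg i2
  rw [integral_const_mul, e, integral_indicator_one h1,
    integral_indicator_one h2, volume_real_carrier, volume_real_carrier]
  simp [length, left, right]

theorem haar_mul_self (I : DyadicInterval) (t : ℝ) :
    I.haar t * I.haar t = I.length⁻¹ * I.carrier.indicator 1 t := by
  have hL := I.length_pos
  have e : I.length ^ (-(1 / 2 : ℝ)) * I.length ^ (-(1 / 2 : ℝ)) = I.length⁻¹ := by
    rw [← Real.rpow_add hL, ← Real.rpow_neg_one]
    norm_num
  rw [haar, mul_mul_mul_comm, e, ← left_union_right I]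
  congr 1
  by_cases h1 : t ∈ I.left.carrier
  · have h2 := Set.disjoint_left.1 I.disjoint_left_right h1
    simp [h1, h2]
  · by_cases h2 : t ∈ I.right.carrier <;> simp [h1, h2]

theorem integral_haar_mul_self (I : DyadicInterval) : ∫ t, I.haar t * I.haar t = 1 := by
  simp only [haar_mul_self]
  rw [integral_const_mul, integral_indicator_one I.measurableSet_carrier, volume_real_carrier,
    inv_mul_cancel₀ I.length_pos.ne']

/-- Each half of `J` is still at least as long as `I`, hence contains `I` or misses it. -/
theorem haar_eq_of_mem {I J : DyadicInterval} (h : I.1 < J.1) {x y : ℝ} (hx : x ∈ I.carrier)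
    (hy : y ∈ I.carrier) : J.haar x = J.haar y := by
  have key : ∀ K : DyadicInterval, K.1 = J.1 - 1 → (x ∈ K.carrier ↔ y ∈ K.carrier) := by
    intro K hK
    have hle : I.1 ≤ K.1 := by omega
    exact ⟨fun h => carrier_subset_of_mem hle hx h hy, fun h => carrier_subset_of_mem hle hy h hx⟩
  have k1 := key J.left rfl
  have k2 := key J.right rfl
  by_cases h1 : x ∈ J.left.carrier <;> by_cases h2 : x ∈ J.right.carrier <;>
    simp [haar, h1, h2, ← k1, ← k2]

theorem integral_haar_mul_haar_of_lt {I J : DyadicInterval} (h : I.1 < J.1) :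
    ∫ t, I.haar t * J.haar t = 0 := by
  obtain ⟨y, hy⟩ := I.carrier_nonempty
  have : ∀ t, I.haar t * J.haar t = I.haar t * J.haar y := by
    intro t
    by_cases ht : t ∈ I.carrier
    · rw [haar_eq_of_mem h ht hy]
    · simp [haar_eq_zero ht]
  simp only [this]
  rw [integral_mul_const, integral_haar, zero_mul]

theorem integral_haar_mul_haar_of_ne {I J : DyadicInterval} (h : I ≠ J) :
    ∫ t, I.haar t * J.haar t = 0 := by
  rcases lt_trichotomy I.1 J.1 with h1 | h1 | h1
  · exact integral_haar_mul_haar_of_lt h1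
  · obtain ⟨k, m⟩ := I
    obtain ⟨k', n⟩ := J
    obtain rfl : k = k' := h1
    have : ∀ t, haar (k, m) t * haar (k, n) t = 0 := by
      intro t
      by_cases ht : t ∈ carrier (k, m)
      · have : t ∉ carrier (k, n) := fun ht' => h (by rw [eq_of_mem ht ht'])
        rw [haar_eq_zero this, mul_zero]
      · rw [haar_eq_zero ht, zero_mul]
    simp [this]
  · simp only [mul_comm (I.haar _)]
    exact integral_haar_mul_haar_of_lt h1

end DyadicInterval

/-! ### Dyadic rectangles and orthonormality of the tensor Haar functions. -/

namespace DyadicRectangle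

variable {d : ℕ}

theorem measurableSet_carrier (R : DyadicRectangle d) : MeasurableSet R.carrier :=
  MeasurableSet.univ_pi fun j => (R j).measurableSet_carrier

theorem volume_carrier (R : DyadicRectangle d) :
    volume R.carrier = ENNReal.ofReal (∏ j, (R j).length) := by
  rw [carrier, volume_pi_pi, ENNReal.ofReal_prod_of_nonneg fun j _ => (R j).length_pos.le]
  exact Finset.prod_congr rfl fun j _ => (R j).volume_carrier

theorem carrier_subset_apply {R S : DyadicRectangle d} (h : R.carrier ⊆ S.carrier) (j : Fin d) :
    (R j).carrier ⊆ (S j).carrier := by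
  choose x hx using fun j => (R j).carrier_nonempty
  intro t ht
  have := h (show Function.update x j t ∈ R.carrier from fun i _ => by
    rcases eq_or_ne i j with rfl | hi
    · simpa using ht
    · simpa [hi] using hx i)
  simpa using this j (mem_univ _)

theorem measurable_haar (R : DyadicRectangle d) : Measurable R.haar := by
  unfold haar
  exact Finset.measurable_fun_prod _ fun j _ =>
    (R j).measurable_haar.comp (measurable_pi_apply j)

theorem exists_norm_haar_le (R : DyadicRectangle d) : ∃ M, ∀ x, ‖R.haar x‖ ≤ M := by
  refine ⟨∏ j, ((R j).length ^ (-(1 / 2 : ℝ)) * 2), fun x => ?_⟩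
  rw [haar, norm_prod]
  exact Finset.prod_le_prod (fun _ _ => norm_nonneg _) fun j _ => (R j).norm_haar_le _

theorem haar_eq_zero {R : DyadicRectangle d} {x : Fin d → ℝ} {j : Fin d}
    (h : x j ∉ (R j).carrier) : R.haar x = 0 :=
  Finset.prod_eq_zero (Finset.mem_univ j) (DyadicInterval.haar_eq_zero h)

theorem haar_update (R : DyadicRectangle d) (j : Fin d) (x : Fin d → ℝ) (t : ℝ) :
    R.haar (Function.update x j t) =
      (R j).haar t * ∏ i ∈ Finset.univ.erase j, (R i).haar (x i) := by
  rw [haar, ← Finset.mul_prod_erase _ _ (Finset.mem_univ j), Function.update_self]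
  congr 1
  refine Finset.prod_congr rfl fun i hi => ?_
  rw [Function.update_of_ne (Finset.ne_of_mem_erase hi)]

theorem integral_haar_update (R : DyadicRectangle d) (j : Fin d) (x : Fin d → ℝ) :
    ∫ t, R.haar (Function.update x j t) = 0 := by
  simp only [haar_update]
  rw [integral_mul_const, DyadicInterval.integral_haar, zero_mul]

theorem integral_haar_mul_haar (R R' : DyadicRectangle d) :
    ∫ x, R.haar x * R'.haar x = if R = R' then 1 else 0 := by
  simp only [haar, ← Finset.prod_mul_distrib]
  rw [integral_fintype_prod_volume_eq_prod (fun j t => (R j).haar t * (R' j).haar t)]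
  split_ifs with h
  · subst h
    simp [DyadicInterval.integral_haar_mul_self]
  · obtain ⟨j, hj⟩ := Function.ne_iff.1 h
    exact Finset.prod_eq_zero (Finset.mem_univ j) (DyadicInterval.integral_haar_mul_haar_of_ne hj)

end DyadicRectangle

/-! ### Siblings, and the potential kernel between them. -/

namespace DyadicInterval

/-- Two distinct dyadic intervals with the same parent. -/
def IsSibling (A B : DyadicInterval) : Prop := A.1 = B.1 ∧ A.2 ≠ B.2 ∧ A.2 / 2 = B.2 / 2

/-- The other half of the parent of `I`. -/
def sibling (I : DyadicInterval) : DyadicInterval := (I.1, I.2 + 1 - 2 * (I.2 % 2))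

theorem isSibling_sibling (I : DyadicInterval) : IsSibling I I.sibling := by
  simp only [IsSibling, sibling, true_and]
  omega

theorem IsSibling.symm {A B : DyadicInterval} (h : IsSibling A B) : IsSibling B A :=
  ⟨h.1.symm, h.2.1.symm, h.2.2.symm⟩

theorem IsSibling.length_eq {A B : DyadicInterval} (h : IsSibling A B) : A.length = B.length := by
  rw [length, length, h.1]

theorem IsSibling.not_mem {A B : DyadicInterval} (h : IsSibling A B) {t : ℝ}
    (hA : t ∈ A.carrier) : t ∉ B.carrier := by
  obtain ⟨k, m⟩ := A
  obtain ⟨k', n⟩ := B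
  obtain ⟨rfl, h2, -⟩ := h
  exact fun hB => h2 (eq_of_mem hA hB)

/-- A dyadic interval that meets `B` and is strictly longer contains the parent of `B`, which is
also the parent of `A`. -/
theorem IsSibling.subset {A B I : DyadicInterval} (h : IsSibling A B) {x : ℝ}
    (hB : x ∈ B.carrier) (hI : x ∈ I.carrier) (hlt : B.1 < I.1) : A.carrier ⊆ I.carrier := by
  obtain ⟨k, m⟩ := A
  obtain ⟨k', n⟩ := B
  obtain ⟨rfl, -, h3⟩ := h
  refine (carrier_subset_succ _ _).trans ?_
  simp only at h3
  rw [h3]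
  exact carrier_subset_of_mem (by simp only at hlt ⊢; omega) (carrier_subset_succ _ _ hB) hI

/-- The value of the kernel of the dyadic Riesz potential on the product of `I` and its
sibling. -/
def kernel (α : ℝ) (I : DyadicInterval) : ℝ :=
  I.length ^ (-α) * ((2 : ℝ) ^ (-α) / (1 - (2 : ℝ) ^ (-α)))

variable {𝕜 : Type*} [RCLike 𝕜]

/-- Only the strict ancestors of `B` contribute. Each contains `A`, so the integral is the same for
all of them and the weights form a geometric series of ratio `2 ^ (-α)`. -/
theorem tsum_indicator_eq {α : ℝ} (hα : 0 < α) {A B : DyadicInterval} (h : IsSibling A B)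
    {g : ℝ → 𝕜} (hg : ∀ t, t ∉ A.carrier → g t = 0) {x : ℝ} (hx : x ∈ B.carrier) :
    ∑' I : DyadicInterval,
      I.carrier.indicator (fun _ => I.length ^ (-α) • ∫ t in I.carrier, g t) x =
    A.kernel α • ∫ t in A.carrier, g t := by
  -- The strict ancestors of `B`, beginning with the parent. The index `0` in the length is
  -- arbitrary, since the length depends only on the scale.
  let e : ℕ → DyadicInterval := fun m =>
    (B.1 + 1 + m, ⌊x / length (B.1 + 1 + m, 0)⌋)
  have he : Function.Injective e := fun m n hmn => by
    have := congrArg Prod.fst hmn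
    simp only [e] at this
    omega
  have hex : ∀ m, x ∈ (e m).carrier := fun m => mem_carrier_iff.2 rfl
  rw [← he.tsum_eq]
  · have hlen : ∀ m : ℕ, (e m).length = A.length * 2 * 2 ^ m := by
      intro m
      simp only [e, length, h.1]
      rw [zpow_add₀ two_ne_zero, zpow_add₀ two_ne_zero, zpow_one, zpow_natCast]
    have hterm : ∀ m, (e m).carrier.indicator
        (fun _ => (e m).length ^ (-α) • ∫ t in (e m).carrier, g t) x =
        (A.length ^ (-α) * 2 ^ (-α) * (2 ^ (-α)) ^ m) • ∫ t in A.carrier, g t := by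
      intro m
      have hsub : A.carrier ⊆ (e m).carrier :=
        h.subset hx (hex m) (by simp only [e]; omega)
      rw [indicator_of_mem (hex m), setIntegral_eq_of_subset_of_forall_sdiff_eq_zero
        (e m).measurableSet_carrier hsub (fun t ht => hg t ht.2), hlen,
        Real.mul_rpow (mul_nonneg A.length_pos.le two_pos.le) (by positivity),
        Real.mul_rpow A.length_pos.le two_pos.le, ← Real.rpow_natCast,
        ← Real.rpow_natCast, ← Real.rpow_mul two_pos.le, ← Real.rpow_mul two_pos.le,
        mul_comm (m : ℝ)]
    simp only [hterm]
    have hlt : (2 : ℝ) ^ (-α) < 1 := Real.rpow_lt_one_of_one_lt_of_neg one_lt_two (by linarith)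
    have hs := ((hasSum_geometric_of_lt_one (Real.rpow_nonneg two_pos.le (-α)) hlt).mul_left
      (A.length ^ (-α) * 2 ^ (-α))).smul_const (∫ t in A.carrier, g t)
    rw [hs.tsum_eq, kernel, div_eq_mul_inv, mul_assoc]
  -- An interval through `x` no longer than `B` lies in `B`, where `g` vanishes; so every nonzero
  -- term comes from a strict ancestor.
  · intro I hI
    rw [Function.mem_support] at hI
    have hxI : x ∈ I.carrier := by
      by_contra hn
      exact hI (indicator_of_notMem hn _)
    rw [indicator_of_mem hxI] at hI
    have hlt : B.1 < I.1 := by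
      by_contra hle
      refine hI ?_
      have hsub : I.carrier ⊆ B.carrier := carrier_subset_of_mem (not_lt.1 hle) hxI hx
      rw [setIntegral_eq_zero_of_forall_eq_zero, smul_zero]
      exact fun t ht => hg t (h.symm.not_mem (hsub ht))
    obtain ⟨r, hr⟩ := Int.le.dest (show B.1 + 1 ≤ I.1 by omega)
    refine ⟨r, ?_⟩
    rw [mem_carrier_iff] at hxI
    ext
    · exact hr
    · simp only [e, ← hxI, length, hr]

end DyadicInterval

variable {𝕜 : Type*} [RCLike 𝕜] {d : ℕ}

theorem potential_eq {α : ℝ} (hα : 0 < α) {A B : DyadicInterval} (h : A.IsSibling B)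
    {j : Fin d} {f : (Fin d → ℝ) → 𝕜} {x : Fin d → ℝ}
    (hf : ∀ t, t ∉ A.carrier → f (Function.update x j t) = 0) (hx : x j ∈ B.carrier) :
    potential α j f x = A.kernel α • ∫ t in A.carrier, f (Function.update x j t) :=
  DyadicInterval.tsum_indicator_eq hα h hf hx

/-! ### Fubini for integration in a single coordinate. -/

/-- Exchange of the `j`-th coordinate of a point with an additional real variable. -/
def swapCoord (j : Fin d) (z : (Fin d → ℝ) × ℝ) : (Fin d → ℝ) × ℝ :=
  (Function.update z.1 j z.2, z.1 j)

theorem measurable_update_uncurry (j : Fin d) :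
    Measurable fun z : (Fin d → ℝ) × ℝ => Function.update z.1 j z.2 :=
  measurable_update'

theorem swapCoord_swapCoord (j : Fin d) (z : (Fin d → ℝ) × ℝ) :
    swapCoord j (swapCoord j z) = z := by
  simp [swapCoord]

/-- `swapCoord` as a measurable equivalence. -/
def swapCoordEquiv (j : Fin d) : (Fin d → ℝ) × ℝ ≃ᵐ (Fin d → ℝ) × ℝ where
  toFun := swapCoord j
  invFun := swapCoord j
  left_inv := swapCoord_swapCoord j
  right_inv := swapCoord_swapCoord j
  measurable_toFun :=
    (measurable_update_uncurry j).prodMk ((measurable_pi_apply j).comp measurable_fst)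
  measurable_invFun :=
    (measurable_update_uncurry j).prodMk ((measurable_pi_apply j).comp measurable_fst)

/-- Once the `j`-th coordinate is split off, the map is `(s, y, t) ↦ (t, y, s)` on a product of
three spaces, a composition of swaps and reassociations. -/
theorem measurePreserving_swapCoord (j : Fin d) :
    MeasurePreserving (swapCoord j) (volume.prod volume) (volume.prod volume) := by
  cases d with
  | zero => exact j.elim0
  | succ n =>
    let e := MeasurableEquiv.piFinSuccAbove (fun _ : Fin (n + 1) => ℝ) j
    have he : MeasurePreserving e volume (volume.prod volume) :=
      volume_preserving_piFinSuccAbove (fun _ : Fin (n + 1) => ℝ) j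
    have h1 : MeasurePreserving (Prod.map e (id : ℝ → ℝ)) (volume.prod volume)
        ((volume.prod volume).prod volume) := he.prod (MeasurePreserving.id volume)
    have h2 : MeasurePreserving (Prod.map e.symm (id : ℝ → ℝ))
        ((volume.prod volume).prod volume) (volume.prod volume) :=
      (he.symm e).prod (MeasurePreserving.id volume)
    have a := measurePreserving_prodAssoc (volume : Measure ℝ) (volume : Measure (Fin n → ℝ))
      (volume : Measure ℝ)
    have b : MeasurePreserving (Prod.swap : ℝ × ((Fin n → ℝ) × ℝ) → _)
      (volume.prod (volume.prod volume)) ((volume.prod volume).prod volume) :=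
      Measure.measurePreserving_swap
    have c := (Measure.measurePreserving_swap (μ := (volume : Measure (Fin n → ℝ)))
      (ν := (volume : Measure ℝ))).prod (MeasurePreserving.id (volume : Measure ℝ))
    have key := h2.comp (c.comp (b.comp (a.comp h1)))
    convert key using 1
    ext z i
    · simp only [swapCoord, Function.comp_apply, Prod.map, id]
      refine Fin.succAboveCases j ?_ (fun i => ?_) i
      · rw [Function.update_self]
        exact (Fin.insertNth_apply_same (α := fun _ => ℝ) j z.2 (e z.1).2).symm
      · rw [Function.update_of_ne (Fin.succAbove_ne j i)]
        exact (Fin.insertNth_apply_succAbove (α := fun _ => ℝ) j z.2 (e z.1).2 i).symm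
    · rfl

/-- Bounded and measurable. -/
def BddMeas (f : (Fin d → ℝ) → 𝕜) : Prop := Measurable f ∧ ∃ M : ℝ, ∀ x, ‖f x‖ ≤ M

/-- Zero outside a bounded set. -/
def BddSupp (f : (Fin d → ℝ) → 𝕜) : Prop := ∃ r : ℝ, ∀ x, r < ‖x‖ → f x = 0

theorem IsTest.of_bddMeas {f : (Fin d → ℝ) → 𝕜} (h : BddMeas f) (h' : BddSupp f) : IsTest f := by
  refine ⟨h.1, h.2, ?_⟩
  obtain ⟨r, hr⟩ := h'
  refine HasCompactSupport.intro (isCompact_closedBall 0 r) fun x hx => hr x ?_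
  simpa using hx

/-- Weighted integral over the set `A` in the `j`-th variable. -/
def slice (κ : ℝ) (A : Set ℝ) (j : Fin d) (f : (Fin d → ℝ) → 𝕜) (x : Fin d → ℝ) : 𝕜 :=
  κ • ∫ t in A, f (Function.update x j t)

/-- The transpose of `slice`. -/
def sliceAdj (κ : ℝ) (A : Set ℝ) (j : Fin d) (g : (Fin d → ℝ) → 𝕜) (x : Fin d → ℝ) : 𝕜 :=
  A.indicator (fun _ => κ • ∫ t, g (Function.update x j t)) (x j)

theorem BddMeas.slice {f : (Fin d → ℝ) → 𝕜} (hf : BddMeas f) (κ : ℝ) {A : Set ℝ}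
    (hA : volume A < ∞) (j : Fin d) : BddMeas (slice κ A j f) := by
  obtain ⟨hm, M, hM⟩ := hf
  refine ⟨?_, ‖κ‖ * (M * volume.real A), fun x => ?_⟩
  · have : StronglyMeasurable fun x : Fin d → ℝ => ∫ t in A, f (Function.update x j t) :=
      (hm.comp (measurable_update_uncurry j)).stronglyMeasurable.integral_prod_right'
    exact this.measurable.const_smul κ
  · rw [DyadicRiesz.slice, norm_smul]
    gcongr
    exact norm_setIntegral_le_of_norm_le_const hA fun t _ => hM _

/-- In the sup norm a point far from the origin either has a large `j`-th coordinate or stays large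
whatever that coordinate becomes. This bounds supports after integration in one variable. -/
theorem lt_norm_update_or {r s : ℝ} (hr : 0 ≤ r) {x : Fin d → ℝ} (h : max r s < ‖x‖) (j : Fin d) :
    s < |x j| ∨ ∀ t, r < ‖Function.update x j t‖ := by
  by_contra! hn
  obtain ⟨h1, t, h2⟩ := hn
  refine absurd h (not_lt.2 ((pi_norm_le_iff_of_nonneg (hr.trans (le_max_left r s))).2 fun i => ?_))
  rcases eq_or_ne i j with rfl | hi
  · exact h1.trans (le_max_right _ _)
  · have := norm_le_pi_norm (Function.update x j t) i
    rw [Function.update_of_ne hi] at this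
    exact (this.trans h2).trans (le_max_left _ _)

theorem exists_abs_le_of_isBounded {A : Set ℝ} (hA : Bornology.IsBounded A) :
    ∃ s, ∀ t ∈ A, |t| ≤ s :=
  hA.exists_norm_le

theorem BddSupp.sliceAdj {g : (Fin d → ℝ) → 𝕜} (hg : BddSupp g) (κ : ℝ) {A : Set ℝ}
    (hA : Bornology.IsBounded A) (j : Fin d) : BddSupp (sliceAdj κ A j g) := by
  obtain ⟨r, hr⟩ := hg
  obtain ⟨s, hs⟩ := exists_abs_le_of_isBounded hA
  refine ⟨max (max r 0) s, fun x hx => ?_⟩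
  rcases lt_norm_update_or (le_max_right r 0) hx j with h | h
  · exact indicator_of_notMem (fun hm => (hs _ hm).not_gt h) _
  · have : ∀ t, g (Function.update x j t) = 0 := fun t => hr _ ((le_max_left _ _).trans_lt (h t))
    simp [DyadicRiesz.sliceAdj, this]

theorem BddMeas.sliceAdj {g : (Fin d → ℝ) → 𝕜} (hg : BddMeas g) (hs : BddSupp g) (κ : ℝ)
    {A : Set ℝ} (hA : MeasurableSet A) (j : Fin d) : BddMeas (sliceAdj κ A j g) := by
  obtain ⟨hm, M, hM⟩ := hg
  obtain ⟨r, hr⟩ := hs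
  have hM0 : 0 ≤ M := (norm_nonneg _).trans (hM 0)
  have hsub : ∀ x, ∫ t, g (Function.update x j t) =
      ∫ t in Icc (-r) r, g (Function.update x j t) := by
    intro x
    refine (setIntegral_eq_integral_of_forall_compl_eq_zero fun t ht => hr _ ?_).symm
    have := norm_le_pi_norm (Function.update x j t) j
    rw [Function.update_self] at this
    refine lt_of_lt_of_le ?_ this
    by_contra hn
    exact ht (abs_le.1 (not_lt.1 hn))
  refine ⟨?_, ‖κ‖ * (M * volume.real (Icc (-r) r)), fun x => ?_⟩
  · have : StronglyMeasurable fun x : Fin d → ℝ => ∫ t, g (Function.update x j t) :=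
      (hm.comp (measurable_update_uncurry j)).stronglyMeasurable.integral_prod_right'
    have h2 : DyadicRiesz.sliceAdj κ A j g =
        ((fun x : Fin d → ℝ => x j) ⁻¹' A).indicator
          (fun x => κ • ∫ t, g (Function.update x j t)) := rfl
    rw [h2]
    exact (this.measurable.const_smul κ).indicator (measurable_pi_apply j hA)
  · refine (norm_indicator_le_norm_self (fun _ => κ • ∫ t, g (Function.update x j t)) (x j)).trans ?_
    rw [norm_smul, hsub]
    gcongr
    exact norm_setIntegral_le_of_norm_le_const (by simp) fun t _ => hM _

/-- The support of `g` confines `t` to `[-r, r]` and, with `x j ∈ A`, confines `x` to a ball. There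
the integrand is a bounded factor times an integrable tensor product. -/
theorem integrable_mul_indicator_mul {F g : (Fin d → ℝ) → 𝕜} (hF : LocallyIntegrable F volume)
    (hg : BddMeas g) (hs : BddSupp g) {A : Set ℝ} (hA : MeasurableSet A)
    (hb : Bornology.IsBounded A) (j : Fin d) :
    Integrable (fun z : (Fin d → ℝ) × ℝ =>
      g (Function.update z.1 j z.2) * A.indicator (fun _ => F z.1) (z.1 j))
      (volume.prod volume) := by
  obtain ⟨hm, M, hM⟩ := hg
  obtain ⟨r, hr⟩ := hs
  obtain ⟨s, hs⟩ := exists_abs_le_of_isBounded hb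
  set C : Set (Fin d → ℝ) := Metric.closedBall 0 (max (max r 0) s)
  have hC : Integrable (C.indicator F) :=
    (integrable_indicator_iff measurableSet_closedBall).2
      (hF.integrableOn_isCompact (isCompact_closedBall _ _))
  have hCA : Integrable (((fun x : Fin d → ℝ => x j) ⁻¹' A).indicator (C.indicator F)) :=
    hC.indicator (measurable_pi_apply j hA)
  have hI : Integrable ((Icc (-r) r).indicator (1 : ℝ → 𝕜)) := by
    rw [integrable_indicator_iff measurableSet_Icc]
    simp [Pi.one_def, integrableOn_const_iff]
  have h1 := (hCA.mul_prod hI).bdd_mul (c := M)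
    (hm.comp (measurable_update_uncurry j)).aestronglyMeasurable (.of_forall fun z => hM _)
  refine h1.congr (.of_forall fun z => ?_)
  obtain ⟨x, t⟩ := z
  simp only [Function.comp_apply]
  by_cases hrt : r < ‖Function.update x j t‖
  · simp [hr _ hrt]
  · have ht : t ∈ Icc (-r) r := by
      have := norm_le_pi_norm (Function.update x j t) j
      rw [Function.update_self] at this
      exact abs_le.1 (this.trans (not_lt.1 hrt))
    congr 1
    by_cases hx : x j ∈ A
    · have hxC : x ∈ C := by
        by_contra hn
        simp only [C, Metric.mem_closedBall, dist_zero_right, not_le] at hn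
        rcases lt_norm_update_or (le_max_right r 0) hn j with h | h
        · exact (hs _ hx).not_gt h
        · exact hrt ((le_max_left _ _).trans_lt (h t))
      simp [hx, hxC, ht]
    · simp [hx]

theorem integrable_mul_slice_uncurry {F g : (Fin d → ℝ) → 𝕜} (hF : LocallyIntegrable F volume)
    (hg : BddMeas g) (hs : BddSupp g) {A : Set ℝ} (hA : MeasurableSet A)
    (hb : Bornology.IsBounded A) (j : Fin d) :
    Integrable (fun z : (Fin d → ℝ) × ℝ =>
      g z.1 * A.indicator (fun t => F (Function.update z.1 j t)) z.2) (volume.prod volume) := by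
  have := (measurePreserving_swapCoord j).integrable_comp_of_integrable
    (integrable_mul_indicator_mul hF hg hs hA hb j)
  refine this.congr (.of_forall fun z => ?_)
  by_cases hz : z.2 ∈ A <;> simp [swapCoord, hz]

/-- Both sides are iterated integrals of one function on `(Fin d → ℝ) × ℝ`, before and after
`swapCoord`. -/
theorem integral_mul_slice {F g : (Fin d → ℝ) → 𝕜} (hF : LocallyIntegrable F volume)
    (hg : BddMeas g) (hs : BddSupp g) (κ : ℝ) {A : Set ℝ} (hA : MeasurableSet A)
    (hb : Bornology.IsBounded A) (j : Fin d) :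
    ∫ x, g x * slice κ A j F x = ∫ x, sliceAdj κ A j g x * F x := by
  have h1 := integral_prod _ (integrable_mul_slice_uncurry hF hg hs hA hb j)
  have h2 := integral_prod _ (integrable_mul_indicator_mul hF hg hs hA hb j)
  have h3 := (measurePreserving_swapCoord j).integral_comp
    (swapCoordEquiv j).measurableEmbedding (fun z : (Fin d → ℝ) × ℝ =>
      g (Function.update z.1 j z.2) * A.indicator (fun _ => F z.1) (z.1 j))
  have h4 : ∀ z : (Fin d → ℝ) × ℝ, g (Function.update (swapCoord j z).1 j (swapCoord j z).2) *
      A.indicator (fun _ => F (swapCoord j z).1) ((swapCoord j z).1 j) =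
      g z.1 * A.indicator (fun t => F (Function.update z.1 j t)) z.2 := by
    intro z
    by_cases hz : z.2 ∈ A <;> simp [swapCoord, hz]
  simp only [h4] at h3
  rw [h1, h2] at h3
  have e1 : ∀ x, g x * slice κ A j F x =
      κ • ∫ t, g x * A.indicator (fun t => F (Function.update x j t)) t := by
    intro x
    rw [integral_const_mul, integral_indicator hA, slice, mul_smul_comm]
  have e2 : ∀ x, sliceAdj κ A j g x * F x =
      κ • ∫ t, g (Function.update x j t) * A.indicator (fun _ => F x) (x j) := by
    intro x
    rw [integral_mul_const, sliceAdj]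
    by_cases hx : x j ∈ A <;> simp [hx]
  simp only [e1, e2, integral_smul]
  rw [h3]

/-- On a compact `K` this is integrability of a marginal in the Fubini statement with `g` the
indicator of `K`. -/
theorem locallyIntegrable_slice {F : (Fin d → ℝ) → 𝕜} (hF : LocallyIntegrable F volume)
    (κ : ℝ) {A : Set ℝ} (hA : MeasurableSet A) (hb : Bornology.IsBounded A) (j : Fin d) :
    LocallyIntegrable (slice κ A j F) volume := by
  rw [locallyIntegrable_iff]
  intro K hK
  obtain ⟨r, hr⟩ := hK.isBounded.exists_norm_le
  set g : (Fin d → ℝ) → 𝕜 := K.indicator 1 with hgdef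
  have hg : BddMeas g := by
    refine ⟨measurable_const.indicator hK.measurableSet, 1, fun x => ?_⟩
    by_cases hx : x ∈ K <;> simp [g, hx]
  have hs : BddSupp g :=
    ⟨r, fun x hx => indicator_of_notMem (fun hm => (hr x hm).not_gt hx) _⟩
  have := (integrable_mul_slice_uncurry hF hg hs hA hb j).integral_prod_left
  rw [← integrable_indicator_iff hK.measurableSet]
  refine (this.smul κ).congr (.of_forall fun x => ?_)
  simp only [Pi.smul_apply]
  rw [integral_const_mul, integral_indicator hA]
  by_cases hx : x ∈ K <;> simp [g, hx, slice]

theorem locallyIntegrable_mul {b f : (Fin d → ℝ) → 𝕜} (hb : LocallyIntegrable b volume)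
    (hf : BddMeas f) : LocallyIntegrable (fun x => b x * f x) volume := by
  obtain ⟨hm, M, hM⟩ := hf
  rw [locallyIntegrable_iff]
  intro K hK
  exact (hb.integrableOn_isCompact hK).mul_bdd (c := M) hm.aestronglyMeasurable (.of_forall hM)

theorem integrable_mul_of_locallyIntegrable {F g : (Fin d → ℝ) → 𝕜}
    (hF : LocallyIntegrable F volume) (hg : BddMeas g) (hs : BddSupp g) :
    Integrable (fun x => g x * F x) := by
  obtain ⟨hm, M, hM⟩ := hg
  obtain ⟨r, hr⟩ := hs
  have := (hF.integrableOn_isCompact (isCompact_closedBall 0 r)).bdd_mul (c := M)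
    hm.aestronglyMeasurable (.of_forall hM)
  refine (integrableOn_iff_integrable_of_support_subset ?_).1 this
  intro x hx
  simp only [Metric.mem_closedBall, dist_zero_right]
  by_contra hn
  exact hx (by simp [hr x (not_le.1 hn)])

/-! ### Iterated commutators and replacement of the potentials by local averages. -/

/-- The iterated commutator of `M_b` with the operators `P j`, `j ∈ l`. -/
def foldComm (P : Fin d → ((Fin d → ℝ) → 𝕜) → ((Fin d → ℝ) → 𝕜)) (b : (Fin d → ℝ) → 𝕜)
    (l : List (Fin d)) : ((Fin d → ℝ) → 𝕜) → ((Fin d → ℝ) → 𝕜) :=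
  l.foldl (fun T j => comm T (P j)) (mulOp b)

section

variable (P : Fin d → ((Fin d → ℝ) → 𝕜) → ((Fin d → ℝ) → 𝕜)) (b : (Fin d → ℝ) → 𝕜)

theorem foldComm_nil : foldComm P b [] = mulOp b := rfl

theorem foldComm_concat (l : List (Fin d)) (j : Fin d) (f : (Fin d → ℝ) → 𝕜) (x : Fin d → ℝ) :
    foldComm P b (l ++ [j]) f x = foldComm P b l (P j f) x - P j (foldComm P b l f) x := by
  rw [foldComm, List.foldl_append]
  rfl

/-- `P j` acts in the `j`-th variable only. -/
def ActsInCoord (P : Fin d → ((Fin d → ℝ) → 𝕜) → ((Fin d → ℝ) → 𝕜)) : Prop :=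
  ∀ j f g x, (∀ t, f (Function.update x j t) = g (Function.update x j t)) → P j f x = P j g x

variable {P b}

/-- Multiplication is pointwise and the operators in `l` move only the coordinates in `l`, so the
other coordinates of `x` act as parameters. -/
theorem foldComm_congr (hP : ActsInCoord P) (l : List (Fin d)) :
    ∀ (f g : (Fin d → ℝ) → 𝕜) (x : Fin d → ℝ),
      (∀ y : Fin d → ℝ, (∀ i, i ∉ l → y i = x i) → f y = g y) →
        foldComm P b l f x = foldComm P b l g x := by
  induction l using List.reverseRecOn with
  | nil =>
    intro f g x h
    simp only [foldComm_nil, mulOp]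
    rw [h x fun _ _ => rfl]
  | append_singleton l j ih =>
    intro f g x h
    have hu : ∀ (y : Fin d → ℝ) (t : ℝ),
        (∀ i, i ∉ l → i ≠ j → y i = x i) → f y = g y := fun y _ hy => h y fun i hi => by
      simp only [List.mem_append, List.mem_singleton, not_or] at hi
      exact hy i hi.1 hi.2
    rw [foldComm_concat, foldComm_concat]
    congr 1
    · refine ih _ _ _ fun y hy => hP _ _ _ _ fun t => hu _ t fun i hi hij => ?_
      rw [Function.update_of_ne hij, hy i hi]
    · refine hP _ _ _ _ fun t => ih _ _ _ fun y hy => hu _ t fun i hi hij => ?_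
      rw [hy i hi, Function.update_of_ne hij]

theorem foldComm_zero (h0 : ∀ j, P j 0 = 0) (l : List (Fin d)) : foldComm P b l 0 = 0 := by
  induction l using List.reverseRecOn with
  | nil => ext x; simp [foldComm_nil, mulOp]
  | append_singleton l j ih =>
    ext x
    rw [foldComm_concat, h0, ih, h0]
    simp

theorem foldComm_eq_zero (hP : ActsInCoord P) (h0 : ∀ j, P j 0 = 0) {l : List (Fin d)}
    {f : (Fin d → ℝ) → 𝕜} {x : Fin d → ℝ}
    (h : ∀ y : Fin d → ℝ, (∀ i, i ∉ l → y i = x i) → f y = 0) : foldComm P b l f x = 0 := by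
  rw [foldComm_congr hP l f 0 x h, foldComm_zero h0]
  rfl

end

theorem actsInCoord_potential (α : ℝ) :
    ActsInCoord (potential α : Fin d → ((Fin d → ℝ) → 𝕜) → ((Fin d → ℝ) → 𝕜)) := by
  intro j f g x h
  simp only [potential, h]

theorem potential_zero (α : ℝ) (j : Fin d) : potential α j (0 : (Fin d → ℝ) → 𝕜) = 0 := by
  ext x
  simp [potential]

/-- The operators `slice` attached to the sides of the rectangle `A`, with the value of the
dyadic Riesz kernel as weight. -/
def slices (α : ℝ) (A : DyadicRectangle d) (j : Fin d) :
    ((Fin d → ℝ) → 𝕜) → ((Fin d → ℝ) → 𝕜) :=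
  slice ((A j).kernel α) (A j).carrier j

/-- The transposes of `slices`. -/
def slicesAdj (α : ℝ) (A : DyadicRectangle d) (j : Fin d) :
    ((Fin d → ℝ) → 𝕜) → ((Fin d → ℝ) → 𝕜) :=
  sliceAdj ((A j).kernel α) (A j).carrier j

theorem actsInCoord_slices (α : ℝ) (A : DyadicRectangle d) :
    ActsInCoord (slices α A : Fin d → ((Fin d → ℝ) → 𝕜) → ((Fin d → ℝ) → 𝕜)) := by
  intro j f g x h
  simp only [slices, slice, h]

theorem slices_zero (α : ℝ) (A : DyadicRectangle d) (j : Fin d) :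
    slices α A j (0 : (Fin d → ℝ) → 𝕜) = 0 := by
  ext x
  simp [slices, slice]

/-- The coordinates are treated one at a time. Since `j ∉ l`, the commutator over `l` preserves both
facts needed to evaluate the `j`-th potential: the evaluation point keeps its `j`-th coordinate in
`B j`, and functions vanishing for `y j ∉ A j` continue to do so. -/
theorem foldComm_potential_eq {α : ℝ} (hα : 0 < α) {A B : DyadicRectangle d}
    (hAB : ∀ j, (A j).IsSibling (B j)) (b : (Fin d → ℝ) → 𝕜) {l : List (Fin d)}
    (hl : l.Nodup) :
    ∀ (f : (Fin d → ℝ) → 𝕜) (x : Fin d → ℝ), (∀ y, ∀ i ∈ l, y i ∉ (A i).carrier → f y = 0) →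
      (∀ i ∈ l, x i ∈ (B i).carrier) →
        foldComm (potential α) b l f x = foldComm (slices α A) b l f x := by
  induction l using List.reverseRecOn with
  | nil => intro f x _ _; rfl
  | append_singleton l j ih =>
    intro f x hf hx
    have hj : j ∉ l := by
      intro h
      rw [List.nodup_append] at hl
      exact hl.2.2 j h j (by simp) rfl
    have hne : ∀ i ∈ l, i ≠ j := fun i hi h => hj (h ▸ hi)
    specialize ih (List.nodup_append.1 hl).1
    have hf' : ∀ y : Fin d → ℝ, y j ∉ (A j).carrier → f y = 0 := fun y => hf y j (by simp)
    have hxj : x j ∈ (B j).carrier := hx j (by simp)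
    have hxl : ∀ i ∈ l, x i ∈ (B i).carrier := fun i hi => hx i (by simp [hi])
    have hPf : ∀ y, ∀ i ∈ l, y i ∉ (A i).carrier → potential α j f y = 0 := by
      intro y i hi hy
      rw [actsInCoord_potential α j f 0 y, potential_zero]
      · rfl
      · intro t
        refine hf _ i (by simp [hi]) ?_
        rwa [Function.update_of_ne (hne i hi)]
    rw [foldComm_concat, foldComm_concat]
    congr 1
    · rw [ih _ _ hPf hxl]
      refine foldComm_congr (actsInCoord_slices α A) l _ _ _ fun y hy => ?_
      refine potential_eq hα (hAB j) (fun t ht => hf' _ (by simpa using ht)) ?_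
      rwa [hy j hj]
    · rw [potential_eq hα (hAB j) _ hxj]
      · simp only [slices, slice]
        congr 2
        ext t
        refine ih _ _ (fun y i hi => hf y i (by simp [hi])) fun i hi => ?_
        rw [Function.update_of_ne (hne i hi)]
        exact hxl i hi
      · intro t ht
        refine foldComm_eq_zero (actsInCoord_potential α) (potential_zero α) fun y hy => ?_
        refine hf' y ?_
        rw [hy j hj]
        simpa using ht

theorem iteratedComm_eq {α : ℝ} (hα : 0 < α) {A B : DyadicRectangle d}
    (hAB : ∀ j, (A j).IsSibling (B j)) (b : (Fin d → ℝ) → 𝕜) {f : (Fin d → ℝ) → 𝕜}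
    (hf : ∀ y, ∀ i, y i ∉ (A i).carrier → f y = 0) {x : Fin d → ℝ} (hx : x ∈ B.carrier) :
    iteratedComm α b f x = foldComm (slices α A) b (List.finRange d) f x :=
  foldComm_potential_eq hα hAB b (List.nodup_finRange d) f x (fun y i _ => hf y i)
    fun i _ => hx i (mem_univ i)

theorem DyadicInterval.isBounded_carrier (I : DyadicInterval) : Bornology.IsBounded I.carrier :=
  Metric.isBounded_Ico _ _

theorem BddMeas.slices {f : (Fin d → ℝ) → 𝕜} (hf : BddMeas f) (α : ℝ) (A : DyadicRectangle d)
    (j : Fin d) : BddMeas (slices α A j f) :=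
  hf.slice _ (A j).isBounded_carrier.measure_lt_top j

theorem locallyIntegrable_foldComm {b : (Fin d → ℝ) → 𝕜} (hb : LocallyIntegrable b volume)
    (α : ℝ) (A : DyadicRectangle d) (l : List (Fin d)) :
    ∀ f : (Fin d → ℝ) → 𝕜, BddMeas f →
      LocallyIntegrable (foldComm (slices α A) b l f) volume := by
  induction l using List.reverseRecOn with
  | nil => exact fun f hf => locallyIntegrable_mul hb hf
  | append_singleton l j ih =>
    intro f hf
    have := (ih _ (hf.slices α A j)).sub (locallyIntegrable_slice (ih f hf) ((A j).kernel α)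
      (A j).measurableSet_carrier (A j).isBounded_carrier j)
    refine this.congr (.of_forall fun x => ?_)
    rw [foldComm_concat]
    rfl

/-! ### Pairings with the commutator and their collapse to a single term. -/

theorem BddMeas.slicesAdj {g : (Fin d → ℝ) → 𝕜} (hg : BddMeas g) (hs : BddSupp g) (α : ℝ)
    (A : DyadicRectangle d) (j : Fin d) : BddMeas (slicesAdj α A j g) :=
  hg.sliceAdj hs _ (A j).measurableSet_carrier j

theorem BddSupp.slicesAdj {g : (Fin d → ℝ) → 𝕜} (hs : BddSupp g) (α : ℝ)
    (A : DyadicRectangle d) (j : Fin d) : BddSupp (slicesAdj α A j g) :=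
  hs.sliceAdj _ (A j).isBounded_carrier j

/-- Local integrability of the inner commutator allows the pairing to be split and the outer
operator to be transposed onto `g`. -/
theorem integral_mul_foldComm_concat {b : (Fin d → ℝ) → 𝕜} (hb : LocallyIntegrable b volume)
    (α : ℝ) (A : DyadicRectangle d) (l : List (Fin d)) (j : Fin d) {f g : (Fin d → ℝ) → 𝕜}
    (hf : BddMeas f) (hg : BddMeas g) (hs : BddSupp g) :
    ∫ x, g x * foldComm (slices α A) b (l ++ [j]) f x =
      (∫ x, g x * foldComm (slices α A) b l (slices α A j f) x) -
        ∫ x, slicesAdj α A j g x * foldComm (slices α A) b l f x := by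
  have hL := locallyIntegrable_foldComm hb α A l
  have h1 := integral_mul_slice (hL f hf) hg hs ((A j).kernel α) (A j).measurableSet_carrier
    (A j).isBounded_carrier j
  have h2 : LocallyIntegrable (slices α A j (foldComm (slices α A) b l f)) volume :=
    locallyIntegrable_slice (hL f hf) ((A j).kernel α) (A j).measurableSet_carrier
    (A j).isBounded_carrier j
  have e : ∫ x, slicesAdj α A j g x * foldComm (slices α A) b l f x =
      ∫ x, g x * slices α A j (foldComm (slices α A) b l f) x := h1.symm
  rw [e, ← integral_sub (integrable_mul_of_locallyIntegrable (hL _ (hf.slices α A j)) hg hs)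
    (integrable_mul_of_locallyIntegrable h2 hg hs)]
  simp only [foldComm_concat, mul_sub]

/-- Any term in which some operator is transposed onto `g` contains an integral of `g` in one
coordinate, which is zero; every operator must fall on `f`. -/
theorem integral_mul_foldComm_of_cancel_left {b : (Fin d → ℝ) → 𝕜}
    (hb : LocallyIntegrable b volume) (α : ℝ) (A : DyadicRectangle d) {g : (Fin d → ℝ) → 𝕜}
    (hg : BddMeas g) (hs : BddSupp g) (h0 : ∀ j x, ∫ t, g (Function.update x j t) = 0)
    (l : List (Fin d)) :
    ∀ f : (Fin d → ℝ) → 𝕜, BddMeas f →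
      ∫ x, g x * foldComm (slices α A) b l f x =
        ∫ x, g x * (b x * l.foldr (slices α A) f x) := by
  induction l using List.reverseRecOn with
  | nil => exact fun f _ => rfl
  | append_singleton l j ih =>
    intro f hf
    rw [integral_mul_foldComm_concat hb α A l j hf hg hs, ih _ (hf.slices α A j),
      List.foldr_append]
    have : slicesAdj α A j g = 0 := by
      ext x
      simp [slicesAdj, sliceAdj, h0]
    simp [this]

/-- The mirror case: every operator must be transposed onto `g`, and each transposition costs a
sign. -/
theorem integral_mul_foldComm_of_cancel_right {b : (Fin d → ℝ) → 𝕜}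
    (hb : LocallyIntegrable b volume) (α : ℝ) (A : DyadicRectangle d) {f : (Fin d → ℝ) → 𝕜}
    (hf : BddMeas f) (h0 : ∀ j, slices α A j f = 0) (l : List (Fin d)) :
    ∀ g : (Fin d → ℝ) → 𝕜, BddMeas g → BddSupp g →
      ∫ x, g x * foldComm (slices α A) b l f x =
        (-1) ^ l.length * ∫ x, l.foldr (slicesAdj α A) g x * (b x * f x) := by
  induction l using List.reverseRecOn with
  | nil => intro g _ _; simp [foldComm_nil, mulOp]
  | append_singleton l j ih =>
    intro g hg hs
    rw [integral_mul_foldComm_concat hb α A l j hf hg hs, h0, foldComm_zero (slices_zero α A),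
      ih _ (hg.slicesAdj hs α A j) (hs.slicesAdj α A j), List.foldr_append]
    simp [pow_succ]

theorem foldr_slices_eq (α : ℝ) (A : DyadicRectangle d) {f : (Fin d → ℝ) → 𝕜} {v : 𝕜}
    (hf : ∀ y ∈ A.carrier, f y = v) (l : List (Fin d)) :
    ∀ x : Fin d → ℝ, (∀ i, i ∉ l → x i ∈ (A i).carrier) →
      l.foldr (slices α A) f x = (l.map fun j => (A j).kernel α * (A j).length).prod • v := by
  induction l with
  | nil =>
    intro x hx
    simp [hf x fun i _ => hx i (by simp)]
  | cons j l ih =>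
    intro x hx
    rw [List.foldr_cons, slices, slice]
    have : ∀ t ∈ (A j).carrier, l.foldr (slices α A) f (Function.update x j t) =
        (l.map fun j => (A j).kernel α * (A j).length).prod • v := by
      intro t ht
      refine ih _ fun i hi => ?_
      rcases eq_or_ne i j with rfl | hij
      · simpa using ht
      · rw [Function.update_of_ne hij]
        exact hx i (by simp [hi, hij])
    rw [setIntegral_congr_fun (A j).measurableSet_carrier this, setIntegral_const,
      DyadicInterval.volume_real_carrier, List.map_cons, List.prod_cons, mul_smul, mul_smul]

theorem foldr_slicesAdj_eq_zero (α : ℝ) (A B : DyadicRectangle d) {g : (Fin d → ℝ) → 𝕜}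
    {j : Fin d} (hg : ∀ y, y j ∉ (B j).carrier → g y = 0) {l : List (Fin d)} (hj : j ∉ l) :
    ∀ y : Fin d → ℝ, y j ∉ (B j).carrier → l.foldr (slicesAdj α A) g y = 0 := by
  induction l with
  | nil => exact hg
  | cons i l ih =>
    intro y hy
    simp only [List.mem_cons, not_or] at hj
    have : ∀ t, l.foldr (slicesAdj α A) g (Function.update y i t) = 0 := fun t =>
      ih hj.2 _ (by rwa [Function.update_of_ne hj.1])
    rw [List.foldr_cons, slicesAdj, sliceAdj]
    simp [this]

/-- Coordinates in `l` have been integrated over `B` and are now restricted to `A`; the remaining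
ones still range over `B`. Without repetitions in `l`, each coordinate makes this change once. -/
theorem foldr_slicesAdj_eq (α : ℝ) (A B : DyadicRectangle d) {g : (Fin d → ℝ) → 𝕜} {v : 𝕜}
    (hg : ∀ y ∈ B.carrier, g y = v) (hg0 : ∀ j y, y j ∉ (B j).carrier → g y = 0)
    {l : List (Fin d)} (hl : l.Nodup) :
    ∀ x : Fin d → ℝ, (∀ i, i ∉ l → x i ∈ (B i).carrier) → (∀ i ∈ l, x i ∈ (A i).carrier) →
      l.foldr (slicesAdj α A) g x = (l.map fun j => (A j).kernel α * (B j).length).prod • v := by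
  induction l with
  | nil =>
    intro x hx _
    simp [hg x fun i _ => hx i (by simp)]
  | cons j l ih =>
    intro x hx hx'
    rw [List.nodup_cons] at hl
    rw [List.foldr_cons, slicesAdj, sliceAdj, indicator_of_mem (hx' j (by simp))]
    have h1 : ∀ t ∈ (B j).carrier, l.foldr (slicesAdj α A) g (Function.update x j t) =
        (l.map fun j => (A j).kernel α * (B j).length).prod • v := by
      intro t ht
      refine ih hl.2 _ (fun i hi => ?_) fun i hi => ?_
      · rcases eq_or_ne i j with rfl | hij
        · simpa using ht
        · rw [Function.update_of_ne hij]
          exact hx i (by simp [hi, hij])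
      · have hij : i ≠ j := fun h => hl.1 (h ▸ hi)
        rw [Function.update_of_ne hij]
        exact hx' i (by simp [hi])
    have h2 : ∀ t, t ∉ (B j).carrier →
        l.foldr (slicesAdj α A) g (Function.update x j t) = 0 := fun t ht =>
      foldr_slicesAdj_eq_zero α A B (hg0 j) hl.1 _ (by simpa using ht)
    rw [← setIntegral_eq_integral_of_forall_compl_eq_zero h2,
      setIntegral_congr_fun (B j).measurableSet_carrier h1, setIntegral_const,
      DyadicInterval.volume_real_carrier, List.map_cons, List.prod_cons, mul_smul, mul_smul]

theorem DyadicRectangle.bddSupp_of_forall {S : DyadicRectangle d} {f : (Fin d → ℝ) → 𝕜}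
    (hf : ∀ j y, y j ∉ (S j).carrier → f y = 0) : BddSupp f := by
  have hb : Bornology.IsBounded S.carrier := by
    exact Bornology.IsBounded.pi fun j => (S j).isBounded_carrier
  obtain ⟨r, hr⟩ := hb.exists_norm_le
  refine ⟨r, fun x hx => ?_⟩
  by_contra h
  refine (hr x fun j _ => ?_).not_gt hx
  by_contra hj
  exact h (hf j x hj)

theorem DyadicRectangle.support_subset_of_forall {S : DyadicRectangle d} {f : (Fin d → ℝ) → 𝕜}
    (hf : ∀ j y, y j ∉ (S j).carrier → f y = 0) : Function.support f ⊆ S.carrier := by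
  intro x hx j _
  by_contra hj
  exact hx (hf j x hj)

theorem DyadicRectangle.integrable_haar_smul {b : (Fin d → ℝ) → 𝕜}
    (hb : LocallyIntegrable b volume) (R : DyadicRectangle d) :
    Integrable fun x => R.haar x • b x := by
  have h1 : BddMeas fun x => (R.haar x : 𝕜) := by
    obtain ⟨M, hM⟩ := R.exists_norm_haar_le
    exact ⟨RCLike.measurable_ofReal.comp R.measurable_haar, M, fun x => by
      rw [RCLike.norm_ofReal]; exact hM x⟩
  have h2 : BddSupp fun x => (R.haar x : 𝕜) :=
    DyadicRectangle.bddSupp_of_forall (S := R) fun j y hy => by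
      rw [DyadicRectangle.haar_eq_zero hy, RCLike.ofReal_zero]
  simpa only [RCLike.real_smul_eq_coe_mul] using integrable_mul_of_locallyIntegrable hb h1 h2

/-! ### Finite Haar sums and their `L²` norms. -/

/-- The finite Haar sum `∑ a_R h_R`. -/
def haarSum (a : DyadicRectangle d → 𝕜) (F : Finset (DyadicRectangle d)) (x : Fin d → ℝ) : 𝕜 :=
  ∑ R ∈ F, R.haar x • a R

section

variable (a : DyadicRectangle d → 𝕜) (F : Finset (DyadicRectangle d))

theorem bddMeas_haarSum : BddMeas (haarSum a F) := by
  choose M hM using fun R : DyadicRectangle d => R.exists_norm_haar_le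
  refine ⟨Finset.measurable_fun_sum _ fun R _ => R.measurable_haar.smul_const _,
    ∑ R ∈ F, M R * ‖a R‖, fun x => (norm_sum_le _ _).trans (Finset.sum_le_sum fun R _ => ?_)⟩
  rw [norm_smul]
  gcongr
  exact hM R x

theorem haarSum_eq_zero {S : DyadicRectangle d} (hF : ∀ R ∈ F, R.carrier ⊆ S.carrier)
    (j : Fin d) (y : Fin d → ℝ) (hy : y j ∉ (S j).carrier) : haarSum a F y = 0 := by
  refine Finset.sum_eq_zero fun R hR => ?_
  rw [DyadicRectangle.haar_eq_zero
    fun h => hy (DyadicRectangle.carrier_subset_apply (hF R hR) j h), zero_smul]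

theorem integral_haarSum_update (j : Fin d) (x : Fin d → ℝ) :
    ∫ t, haarSum a F (Function.update x j t) = 0 := by
  simp only [haarSum]
  rw [integral_finsetSum]
  · refine Finset.sum_eq_zero fun R _ => ?_
    rw [integral_smul_const, R.integral_haar_update, zero_smul]
  · intro R _
    refine Integrable.smul_const ?_ _
    simp only [R.haar_update j x]
    exact (R j).integrable_haar.mul_const _

theorem integral_haarSum_mul {b : (Fin d → ℝ) → 𝕜} (hb : LocallyIntegrable b volume) :
    ∫ x, haarSum a F x * b x = ∑ R ∈ F, a R * haarCoeff b R := by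
  have : ∀ x, haarSum a F x * b x = ∑ R ∈ F, a R * R.haar x • b x := by
    intro x
    rw [haarSum, Finset.sum_mul]
    refine Finset.sum_congr rfl fun R _ => ?_
    rw [smul_mul_assoc, mul_smul_comm]
  simp only [this]
  rw [integral_finsetSum _ fun R _ => (R.integrable_haar_smul hb).const_mul _]
  exact Finset.sum_congr rfl fun R _ => integral_const_mul _ _

/-- The pairing formula `integral_haarSum_mul`, applied with the Haar sum itself as symbol and
conjugated coefficients. -/
theorem integral_norm_haarSum_sq : ∫ x, ‖haarSum a F x‖ ^ 2 = ∑ R ∈ F, ‖a R‖ ^ 2 := by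
  have key : ∫ x, haarSum (fun R => starRingEnd 𝕜 (a R)) F x * haarSum a F x =
      ∑ R ∈ F, starRingEnd 𝕜 (a R) * a R := by
    rw [integral_haarSum_mul]
    · refine Finset.sum_congr rfl fun R hR => ?_
      congr 1
      have : ∀ x, R.haar x • haarSum a F x = ∑ R' ∈ F, (R.haar x * R'.haar x) • a R' := by
        intro x
        simp only [haarSum, Finset.smul_sum, mul_smul]
      rw [haarCoeff]
      simp only [this]
      rw [integral_finsetSum]
      · simp only [integral_smul_const, DyadicRectangle.integral_haar_mul_haar]
        simp [ite_smul, hR]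
      · intro R' _
        refine Integrable.smul_const ?_ _
        have hl : LocallyIntegrable R'.haar volume := by
          obtain ⟨M, hM⟩ := R'.exists_norm_haar_le
          simpa using locallyIntegrable_mul (b := fun _ => (1 : ℝ)) (f := R'.haar)
            (locallyIntegrable_const _) ⟨R'.measurable_haar, M, hM⟩
        exact R.integrable_haar_smul hl
    · simpa using locallyIntegrable_mul (b := fun _ => (1 : 𝕜))
        (locallyIntegrable_const _) (bddMeas_haarSum a F)
  have hconj : ∀ x, haarSum (fun R => starRingEnd 𝕜 (a R)) F x * haarSum a F x =
      ((‖haarSum a F x‖ ^ 2 : ℝ) : 𝕜) := by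
    intro x
    have : haarSum (fun R => starRingEnd 𝕜 (a R)) F x = starRingEnd 𝕜 (haarSum a F x) := by
      simp [haarSum, RCLike.real_smul_eq_coe_mul]
    rw [this, RCLike.conj_mul, RCLike.ofReal_pow]
  simp only [hconj, RCLike.conj_mul] at key
  rw [integral_ofReal] at key
  exact_mod_cast key

theorem eLpNorm_haarSum (S : DyadicRectangle d) (hF : ∀ R ∈ F, R.carrier ⊆ S.carrier) :
    eLpNorm (haarSum a F) 2 volume =
      ENNReal.ofReal ((∑ R ∈ F, ‖a R‖ ^ 2) ^ (1 / 2 : ℝ)) := by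
  obtain ⟨hm, M, hM⟩ := bddMeas_haarSum a F
  have hi : Integrable fun x => ‖haarSum a F x‖ ^ 2 := by
    have h1 : BddSupp fun x => ‖haarSum a F x‖ :=
      DyadicRectangle.bddSupp_of_forall (S := S) (𝕜 := ℝ) fun j y hy => by
        simp [haarSum_eq_zero a F hF j y hy]
    have h2 : BddMeas fun x => ‖haarSum a F x‖ := ⟨hm.norm, M, fun x => by simpa using hM x⟩
    have h3 : LocallyIntegrable (fun x => ‖haarSum a F x‖) volume := by
      simpa using locallyIntegrable_mul (b := fun _ => (1 : ℝ)) (locallyIntegrable_const _) h2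
    simpa only [sq] using integrable_mul_of_locallyIntegrable h3 h2 h1
  rw [eLpNorm_eq_lintegral_rpow_enorm_toReal two_ne_zero ENNReal.ofNat_ne_top,
    ← integral_norm_haarSum_sq, ← ENNReal.ofReal_rpow_of_nonneg (integral_nonneg fun x => sq_nonneg _)
      (by norm_num), ofReal_integral_eq_lintegral_ofReal hi (.of_forall fun x => sq_nonneg _)]
  simp only [ENNReal.toReal_ofNat, ENNReal.rpow_ofNat]
  congr 2
  ext x
  rw [ENNReal.ofReal_pow (norm_nonneg _), ofReal_norm]

end

/-! ### Hölder estimates and the lower bound. -/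

theorem enorm_integral_mul_le {X : Type*} [MeasurableSpace X] {μ : Measure X} {g H : X → 𝕜}
    (hg : AEStronglyMeasurable g μ) (hH : AEStronglyMeasurable H μ) (r' r : ℝ≥0∞)
    [ENNReal.HolderTriple r' r 1] :
    ‖∫ x, g x * H x ∂μ‖ₑ ≤ eLpNorm g r' μ * eLpNorm H r μ := by
  refine (enorm_integral_le_lintegral_enorm _).trans ?_
  have h := eLpNorm_smul_le_mul_eLpNorm (p := r') (q := r) (r := 1) hH hg
  rwa [eLpNorm_one_eq_lintegral_enorm] at h

/-- The pairing sees only `B`, where the local model agrees with the true commutator. Hölder there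
uses the exponent `r ≤ q`, and passing from `L^r` to `L^q` costs a power of `|B|`. -/
theorem norm_integral_mul_foldComm_le {α : ℝ} (hα : 0 < α) {A B : DyadicRectangle d}
    (hAB : ∀ j, (A j).IsSibling (B j)) {b : (Fin d → ℝ) → 𝕜} (hb : LocallyIntegrable b volume)
    {p q : ℝ≥0∞} {r' r : ℝ≥0∞} [ENNReal.HolderTriple r' r 1] (hr : r ≤ q)
    {f g : (Fin d → ℝ) → 𝕜} (hf : BddMeas f) (hfA : ∀ j y, y j ∉ (A j).carrier → f y = 0)
    (hfp : eLpNorm f p volume ≤ 1) (hg : BddMeas g)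
    (hgB : ∀ j y, y j ∉ (B j).carrier → g y = 0) {y : ℝ} (hy : 0 ≤ y)
    (hgy : eLpNorm g r' volume ≤ ENNReal.ofReal y) (hN : opNorm p q (iteratedComm α b) ≠ ⊤) :
    ‖∫ x, g x * foldComm (slices α A) b (List.finRange d) f x‖ ≤
      y * (opNorm p q (iteratedComm α b)).toReal *
        (∏ j, (B j).length) ^ (1 / r.toReal - 1 / q.toReal) := by
  set H := foldComm (slices α A) b (List.finRange d) f
  have hH : LocallyIntegrable H volume := locallyIntegrable_foldComm hb α A _ f hf
  have hV : 0 < ∏ j, (B j).length := Finset.prod_pos fun j _ => (B j).length_pos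
  have hm : AEStronglyMeasurable H (volume.restrict B.carrier) :=
    hH.aestronglyMeasurable.restrict
  have hgB' : ∀ x, x ∉ B.carrier → g x * H x = 0 := by
    intro x hx
    rw [Function.notMem_support.1
      fun h => hx (DyadicRectangle.support_subset_of_forall hgB h), zero_mul]
  have h1 : ‖∫ x, g x * H x‖ₑ ≤
      eLpNorm g r' (volume.restrict B.carrier) * eLpNorm H r (volume.restrict B.carrier) := by
    rw [← setIntegral_eq_integral_of_forall_compl_eq_zero hgB']
    exact enorm_integral_mul_le hg.1.aestronglyMeasurable hm r' r
  have h2 : eLpNorm H r (volume.restrict B.carrier) ≤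
      opNorm p q (iteratedComm α b) *
        ENNReal.ofReal ((∏ j, (B j).length) ^ (1 / r.toReal - 1 / q.toReal)) := by
    refine (eLpNorm_le_eLpNorm_mul_rpow_measure_univ hr hm).trans ?_
    rw [Measure.restrict_apply_univ, B.volume_carrier, ENNReal.ofReal_rpow_of_pos hV]
    gcongr
    have : eLpNorm H q (volume.restrict B.carrier) =
        eLpNorm (iteratedComm α b f) q (volume.restrict B.carrier) := by
      refine eLpNorm_congr_ae ((ae_restrict_mem B.measurableSet_carrier).mono fun x hx => ?_)
      exact (iteratedComm_eq hα hAB b (fun y i => hfA i y) hx).symm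
    rw [this]
    refine (eLpNorm_mono_measure _ Measure.restrict_le_self).trans ?_
    exact le_iSup_of_le f (le_iSup_of_le
      (IsTest.of_bddMeas hf (DyadicRectangle.bddSupp_of_forall hfA)) (le_iSup_of_le hfp le_rfl))
  have h3 := h1.trans (mul_le_mul' ((eLpNorm_mono_measure g Measure.restrict_le_self).trans hgy) h2)
  rw [← ENNReal.ofReal_toReal hN, ← ofReal_norm, ← ENNReal.ofReal_mul ENNReal.toReal_nonneg,
    ← ENNReal.ofReal_mul hy, ENNReal.ofReal_le_ofReal_iff (by positivity)] at h3
  rwa [← mul_assoc] at h3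

theorem DyadicRectangle.prod_kernel_mul_length (α : ℝ) (A : DyadicRectangle d) :
    ((List.finRange d).map fun j => (A j).kernel α * (A j).length).prod =
      ((2 : ℝ) ^ (-α) / (1 - (2 : ℝ) ^ (-α))) ^ d * (∏ j, (A j).length) ^ (1 - α) := by
  have hL : ∀ j, (A j).kernel α * (A j).length =
      ((2 : ℝ) ^ (-α) / (1 - (2 : ℝ) ^ (-α))) * (A j).length ^ (1 - α) := by
    intro j
    rw [DyadicInterval.kernel, sub_eq_add_neg 1 α, Real.rpow_add (A j).length_pos, Real.rpow_one]
    ring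
  rw [← Fin.prod_univ_def, Finset.prod_congr rfl fun j _ => hL j, Finset.prod_mul_distrib,
    Real.finsetProd_rpow _ _ fun j _ => (A j).length_pos.le,
    Finset.prod_const, Finset.card_univ, Fintype.card_fin]

theorem bddMeas_indicator (A : DyadicRectangle d) (v : 𝕜) :
    BddMeas (A.carrier.indicator fun _ => v) :=
  ⟨measurable_const.indicator A.measurableSet_carrier, ‖v‖, fun _ =>
    norm_indicator_le_norm_self (fun _ => v) _⟩

theorem indicator_eq_zero (A : DyadicRectangle d) (v : 𝕜) (j : Fin d) (y : Fin d → ℝ)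
    (hy : y j ∉ (A j).carrier) : A.carrier.indicator (fun _ => v) y = 0 :=
  indicator_of_notMem (fun h : y ∈ A.carrier => hy (h j (mem_univ j))) _

theorem sum_conj_mul_haarCoeff (b : (Fin d → ℝ) → 𝕜) (F : Finset (DyadicRectangle d)) :
    ∑ R ∈ F, starRingEnd 𝕜 (haarCoeff b R) * haarCoeff b R =
      ((∑ R ∈ F, ‖haarCoeff b R‖ ^ 2 : ℝ) : 𝕜) := by
  rw [RCLike.ofReal_sum]
  exact Finset.sum_congr rfl fun R _ => by rw [RCLike.conj_mul, RCLike.ofReal_pow]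

section

variable {α p q : ℝ} {b : (Fin d → ℝ) → 𝕜} {S S' : DyadicRectangle d}
  {F : Finset (DyadicRectangle d)}

/-- Here `f` is the normalised indicator of the sibling rectangle `S'`, `g` is the Haar sum on `S`,
and Hölder is used with exponents `2, 2`. -/
theorem mul_sum_le_of_two_le (hα : 0 < α) (hp : 0 < p) (hq : 2 ≤ q)
    (hb : LocallyIntegrable b volume) (hS : ∀ j, (S' j).IsSibling (S j))
    (hF : ∀ R ∈ F, R.carrier ⊆ S.carrier)
    (hN : opNorm (.ofReal p) (.ofReal q) (iteratedComm α b) ≠ ⊤) :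
    ((2 : ℝ) ^ (-α) / (1 - (2 : ℝ) ^ (-α))) ^ d * (∏ j, (S j).length) ^ (1 - α - 1 / p) *
        ∑ R ∈ F, ‖haarCoeff b R‖ ^ 2 ≤
      (∑ R ∈ F, ‖haarCoeff b R‖ ^ 2) ^ (1 / 2 : ℝ) *
        (opNorm (.ofReal p) (.ofReal q) (iteratedComm α b)).toReal *
        (∏ j, (S j).length) ^ (1 / 2 - 1 / q) := by
  set V := ∏ j, (S j).length with hVdef
  have hV : 0 < V := Finset.prod_pos fun j _ => (S j).length_pos
  have hV' : ∏ j, (S' j).length = V := Finset.prod_congr rfl fun j _ => (hS j).length_eq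
  set a : DyadicRectangle d → 𝕜 := fun R => starRingEnd 𝕜 (haarCoeff b R) with ha
  have hσ : ∑ R ∈ F, ‖a R‖ ^ 2 = ∑ R ∈ F, ‖haarCoeff b R‖ ^ 2 := by simp [a]
  set σ := ∑ R ∈ F, ‖haarCoeff b R‖ ^ 2 with hσdef
  have hσ0 : 0 ≤ σ := Finset.sum_nonneg fun R _ => sq_nonneg _
  set s : 𝕜 := ((V ^ (-(1 / p)) : ℝ) : 𝕜) with hs
  have hfp : eLpNorm (S'.carrier.indicator fun _ => s) (.ofReal p) volume ≤ 1 := by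
    rw [eLpNorm_indicator_const S'.measurableSet_carrier (by simpa using hp)
      ENNReal.ofReal_ne_top, S'.volume_carrier, hV', ENNReal.toReal_ofReal hp.le, hs,
      ← ofReal_norm, RCLike.norm_ofReal, abs_of_pos (Real.rpow_pos_of_pos hV _),
      ENNReal.ofReal_rpow_of_pos hV, ← ENNReal.ofReal_mul (Real.rpow_nonneg hV.le _),
      ← Real.rpow_add hV, neg_add_cancel, Real.rpow_zero, ENNReal.ofReal_one]
  have key := norm_integral_mul_foldComm_le (r := 2) (r' := 2) hα hS hb
    (by rw [← ENNReal.ofReal_ofNat]; exact ENNReal.ofReal_le_ofReal hq)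
    (bddMeas_indicator S' s) (indicator_eq_zero S' s) hfp (bddMeas_haarSum a F)
    (haarSum_eq_zero a F hF) (Real.rpow_nonneg hσ0 (1 / 2 : ℝ))
    (by rw [eLpNorm_haarSum a F S hF, hσ]) hN
  rw [integral_mul_foldComm_of_cancel_left hb α S' (bddMeas_haarSum a F)
    (DyadicRectangle.bddSupp_of_forall (haarSum_eq_zero a F hF)) (integral_haarSum_update a F)
    _ _ (bddMeas_indicator S' s)] at key
  have hval : ∀ x, (List.finRange d).foldr (slices α S')
      (S'.carrier.indicator fun _ => s) x =
      ((((2 : ℝ) ^ (-α) / (1 - (2 : ℝ) ^ (-α))) ^ d * V ^ (1 - α) * V ^ (-(1 / p)) : ℝ) : 𝕜) := by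
    intro x
    rw [foldr_slices_eq α S' (v := s) (fun y hy => indicator_of_mem hy _) _ x (by simp),
      S'.prod_kernel_mul_length, hV', hs, RCLike.real_smul_eq_coe_mul, ← RCLike.ofReal_mul]
  simp only [hval, ← mul_assoc] at key
  have hc : 0 < (2 : ℝ) ^ (-α) / (1 - (2 : ℝ) ^ (-α)) :=
    div_pos (Real.rpow_pos_of_pos two_pos _)
      (sub_pos.2 (Real.rpow_lt_one_of_one_lt_of_neg one_lt_two (by linarith)))
  rw [integral_mul_const, integral_haarSum_mul a F hb, ha, sum_conj_mul_haarCoeff, ← hσdef,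
    ← RCLike.ofReal_mul, RCLike.norm_ofReal, abs_of_nonneg (by positivity),
    ENNReal.toReal_ofReal (by linarith), ENNReal.toReal_ofNat] at key
  refine le_trans (le_of_eq ?_) key
  rw [sub_eq_add_neg (1 - α), Real.rpow_add hV]
  ring

/-- The roles are exchanged: `f` is a multiple of the Haar sum on `S`, `g` is the indicator of `S'`,
and Hölder is used with exponents `∞, 1`. -/
theorem mul_rpow_sum_le_of_lt_two (hα : 0 < α) (hp : 0 < p) (hp2 : p ≤ 2) (hq : 1 ≤ q)
    (hb : LocallyIntegrable b volume) (hS : ∀ j, (S j).IsSibling (S' j))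
    (hF : ∀ R ∈ F, R.carrier ⊆ S.carrier) (hpos : 0 < ∑ R ∈ F, ‖haarCoeff b R‖ ^ 2)
    (hN : opNorm (.ofReal p) (.ofReal q) (iteratedComm α b) ≠ ⊤) :
    ((2 : ℝ) ^ (-α) / (1 - (2 : ℝ) ^ (-α))) ^ d * (∏ j, (S j).length) ^ (1 - α + 1 / 2 - 1 / p) *
        (∑ R ∈ F, ‖haarCoeff b R‖ ^ 2) ^ (1 / 2 : ℝ) ≤
      (opNorm (.ofReal p) (.ofReal q) (iteratedComm α b)).toReal *
        (∏ j, (S j).length) ^ (1 - 1 / q) := by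
  set V := ∏ j, (S j).length with hVdef
  have hV : 0 < V := Finset.prod_pos fun j _ => (S j).length_pos
  have hV' : ∏ j, (S' j).length = V := Finset.prod_congr rfl fun j _ => (hS j).length_eq.symm
  set σ := ∑ R ∈ F, ‖haarCoeff b R‖ ^ 2 with hσdef
  -- The reciprocal of `σ ^ (1/2) * V ^ (1/p - 1/2)`, the bound for the `L^p` norm of the Haar sum
  -- obtained from its `L²` norm on `S`.
  set s : ℝ := σ ^ (-(1 / 2) : ℝ) * V ^ (1 / 2 - 1 / p) with hs
  have hs0 : 0 < s := by positivity
  set a : DyadicRectangle d → 𝕜 := fun R => starRingEnd 𝕜 (haarCoeff b R) with ha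
  have hσ : ∑ R ∈ F, ‖a R‖ ^ 2 = σ := by simp [a, hσdef]
  have hG := haarSum_eq_zero a F hF
  set f : (Fin d → ℝ) → 𝕜 := (s : 𝕜) • haarSum a F with hfdef
  have hf : BddMeas f := by
    obtain ⟨hm, M, hM⟩ := bddMeas_haarSum a F
    refine ⟨hm.const_smul _, ‖(s : 𝕜)‖ * M, fun x => ?_⟩
    rw [hfdef, Pi.smul_apply, norm_smul]
    gcongr
    exact hM x
  have hfA : ∀ j y, y j ∉ (S j).carrier → f y = 0 := fun j y hy => by
    rw [hfdef, Pi.smul_apply, hG j y hy, smul_zero]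
  have hfp : eLpNorm f (.ofReal p) volume ≤ 1 := by
    rw [hfdef, eLpNorm_const_smul,
      ← eLpNorm_restrict_eq_of_support_subset (DyadicRectangle.support_subset_of_forall hG)]
    have h1 := eLpNorm_le_eLpNorm_mul_rpow_measure_univ (μ := volume.restrict S.carrier)
      (f := haarSum a F) (p := .ofReal p) (q := 2)
      (by rw [← ENNReal.ofReal_ofNat]; exact ENNReal.ofReal_le_ofReal hp2)
      (bddMeas_haarSum a F).1.aestronglyMeasurable
    rw [eLpNorm_restrict_eq_of_support_subset (DyadicRectangle.support_subset_of_forall hG)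
      (p := 2), eLpNorm_haarSum a F S hF, hσ, Measure.restrict_apply_univ, S.volume_carrier,
      ENNReal.ofReal_rpow_of_pos hV, ENNReal.toReal_ofReal hp.le, ENNReal.toReal_ofNat,
      ← ENNReal.ofReal_mul (by positivity)] at h1
    refine (mul_le_mul_right h1 _).trans ?_
    rw [← ofReal_norm, RCLike.norm_ofReal, abs_of_pos hs0, ← ENNReal.ofReal_mul hs0.le,
      ENNReal.ofReal_le_one, hs]
    have e1 : σ ^ (-(1 / 2) : ℝ) * σ ^ (1 / 2 : ℝ) = 1 := by
      rw [← Real.rpow_add hpos]; norm_num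
    have e2 : V ^ (1 / 2 - 1 / p) * V ^ (1 / p - 1 / 2) = 1 := by
      rw [← Real.rpow_add hV]; norm_num
    rw [mul_mul_mul_comm, e1, e2, one_mul]
  have hgy : eLpNorm (S'.carrier.indicator fun _ => (1 : 𝕜)) ⊤ volume ≤ ENNReal.ofReal 1 := by
    refine (eLpNorm_indicator_const_le _ _).trans ?_
    simp
  have key := norm_integral_mul_foldComm_le (r := 1) (r' := ⊤) hα hS hb
    (by rw [← ENNReal.ofReal_one]; exact ENNReal.ofReal_le_ofReal hq)
    hf hfA hfp (bddMeas_indicator S' 1) (indicator_eq_zero S' 1) zero_le_one hgy hN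
  have hcancel : ∀ j, slices α S j f = 0 := by
    intro j
    ext x
    simp only [slices, slice, Pi.zero_apply]
    rw [setIntegral_eq_integral_of_forall_compl_eq_zero
      fun t ht => hfA j _ (by rwa [Function.update_self])]
    simp only [hfdef, Pi.smul_apply]
    rw [integral_smul, integral_haarSum_update, smul_zero, smul_zero]
  rw [integral_mul_foldComm_of_cancel_right hb α S hf hcancel _ _ (bddMeas_indicator S' 1)
    (DyadicRectangle.bddSupp_of_forall (indicator_eq_zero S' 1))] at key
  have hval : ∀ x, (List.finRange d).foldr (slicesAdj α S)
      (S'.carrier.indicator fun _ => (1 : 𝕜)) x * (b x * f x) =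
      ((((2 : ℝ) ^ (-α) / (1 - (2 : ℝ) ^ (-α))) ^ d * V ^ (1 - α) * s : ℝ) : 𝕜) *
        (haarSum a F x * b x) := by
    intro x
    by_cases hx : x ∈ S.carrier
    · have hlen : ∀ j, (S j).kernel α * (S' j).length = (S j).kernel α * (S j).length :=
        fun j => by rw [(hS j).length_eq]
      rw [foldr_slicesAdj_eq α S S' (v := 1) (fun y hy => indicator_of_mem hy _)
        (indicator_eq_zero S' 1) (List.nodup_finRange d) x (by simp) fun j _ => hx j (mem_univ j)]
      simp only [hlen]
      rw [S.prod_kernel_mul_length, hfdef, Pi.smul_apply, smul_eq_mul,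
        RCLike.real_smul_eq_coe_mul, RCLike.ofReal_mul _ s]
      ring
    · have : haarSum a F x = 0 := Function.notMem_support.1
        fun h => hx (DyadicRectangle.support_subset_of_forall hG h)
      simp [hfdef, this]
  simp only [hval] at key
  have hc : 0 < (2 : ℝ) ^ (-α) / (1 - (2 : ℝ) ^ (-α)) :=
    div_pos (Real.rpow_pos_of_pos two_pos _)
      (sub_pos.2 (Real.rpow_lt_one_of_one_lt_of_neg one_lt_two (by linarith)))
  rw [integral_const_mul, integral_haarSum_mul a F hb, ha, sum_conj_mul_haarCoeff, ← hσdef,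
    ← RCLike.ofReal_mul, norm_mul, norm_pow, norm_neg, norm_one, one_pow, one_mul,
    RCLike.norm_ofReal, abs_of_nonneg (by positivity), one_mul, hV',
    ENNReal.toReal_ofReal (by linarith), ENNReal.toReal_one, div_one] at key
  refine le_trans (le_of_eq ?_) key
  have e1 : σ ^ (-(1 / 2) : ℝ) * σ = σ ^ (1 / 2 : ℝ) := by
    nth_rewrite 2 [← Real.rpow_one σ]
    rw [← Real.rpow_add hpos]; norm_num
  rw [hs, add_sub_assoc, Real.rpow_add hV, ← e1]
  ring

theorem mul_rpow_sum_le (hα : 0 < α) (hp : 1 < p) (hpq : p < q)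
    (hαpq : 1 - α + 1 / q = 1 / p) (hb : LocallyIntegrable b volume)
    (hF : ∀ R ∈ F, R.carrier ⊆ S.carrier)
    (hN : opNorm (.ofReal p) (.ofReal q) (iteratedComm α b) ≠ ⊤) :
    ((2 : ℝ) ^ (-α) / (1 - (2 : ℝ) ^ (-α))) ^ d *
        (∑ R ∈ F, ‖haarCoeff b R‖ ^ 2) ^ (1 / 2 : ℝ) ≤
      (opNorm (.ofReal p) (.ofReal q) (iteratedComm α b)).toReal *
        (∏ j, (S j).length) ^ (1 / 2 : ℝ) := by
  have hS : ∀ j, (S j).IsSibling (S j).sibling := fun j => (S j).isSibling_sibling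
  set V := ∏ j, (S j).length with hVdef
  have hV : 0 < V := Finset.prod_pos fun j _ => (S j).length_pos
  have hσ0 : 0 ≤ ∑ R ∈ F, ‖haarCoeff b R‖ ^ 2 := Finset.sum_nonneg fun R _ => sq_nonneg _
  rcases hσ0.eq_or_lt with h0 | hpos
  · rw [← h0, Real.zero_rpow (by norm_num), mul_zero]
    positivity
  rcases le_or_gt 2 q with hq | hq
  · have key := mul_sum_le_of_two_le hα (by linarith) hq hb (fun j => (hS j).symm) hF hN
    rw [← hVdef] at key
    set σ := ∑ R ∈ F, ‖haarCoeff b R‖ ^ 2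
    have e1 : σ = σ ^ (1 / 2 : ℝ) * σ ^ (1 / 2 : ℝ) := by
      rw [← Real.rpow_add hpos]; norm_num
    -- The relation `1 - α + 1/q = 1/p` enters here, leaving exactly `V ^ (1/2)`; the case `q < 2`
    -- uses it in the same way.
    have e2 : V ^ (1 / 2 - 1 / q) = V ^ (1 - α - 1 / p) * V ^ (1 / 2 : ℝ) := by
      rw [← Real.rpow_add hV]
      congr 1
      linarith
    rw [e2] at key
    nth_rewrite 1 [e1] at key
    have h1 : 0 < σ ^ (1 / 2 : ℝ) * V ^ (1 - α - 1 / p) := by positivity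
    refine le_of_mul_le_mul_left ?_ h1
    linarith
  · have key := mul_rpow_sum_le_of_lt_two hα (by linarith) (by linarith) (by linarith) hb hS hF
      hpos hN
    rw [← hVdef] at key
    have e2 : V ^ (1 - 1 / q) = V ^ (1 - α + 1 / 2 - 1 / p) * V ^ (1 / 2 : ℝ) := by
      rw [← Real.rpow_add hV]
      congr 1
      linarith
    rw [e2] at key
    have h1 : 0 < V ^ (1 - α + 1 / 2 - 1 / p) := by positivity
    refine le_of_mul_le_mul_left ?_ h1
    linarith

theorem ofReal_mul_rectBMO_le (hα : 0 < α) (hp : 1 < p) (hpq : p < q)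
    (hαpq : 1 - α + 1 / q = 1 / p) (hb : LocallyIntegrable b volume) :
    ENNReal.ofReal (((2 : ℝ) ^ (-α) / (1 - (2 : ℝ) ^ (-α))) ^ d) * rectBMO b ≤
      opNorm (.ofReal p) (.ofReal q) (iteratedComm α b) := by
  by_cases hN : opNorm (.ofReal p) (.ofReal q) (iteratedComm α b) = ⊤
  · rw [hN]
    exact le_top
  set n := (opNorm (.ofReal p) (.ofReal q) (iteratedComm α b)).toReal with hn
  have hc : 0 < ((2 : ℝ) ^ (-α) / (1 - (2 : ℝ) ^ (-α))) ^ d :=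
    pow_pos (div_pos (Real.rpow_pos_of_pos two_pos _)
      (sub_pos.2 (Real.rpow_lt_one_of_one_lt_of_neg one_lt_two (by linarith)))) d
  set c := ((2 : ℝ) ^ (-α) / (1 - (2 : ℝ) ^ (-α))) ^ d with hcdef
  have hn0 : 0 ≤ n := ENNReal.toReal_nonneg
  rw [rectBMO, ENNReal.mul_iSup]
  refine iSup_le fun S => ?_
  have hV : 0 < ∏ j, (S j).length := Finset.prod_pos fun j _ => (S j).length_pos
  have hbound : ∑' R : {R : DyadicRectangle d // R.carrier ⊆ S.carrier},
      ‖haarCoeff b (R : DyadicRectangle d)‖ₑ ^ 2 ≤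
      ENNReal.ofReal ((∏ j, (S j).length) * (n / c) ^ 2) := by
    -- Finite subfamilies suffice, and only for them is the Haar sum known to be an admissible
    -- bounded test function.
    rw [ENNReal.tsum_eq_iSup_sum]
    refine iSup_le fun F' => ?_
    have key := mul_rpow_sum_le (S := S) (F := F'.map (Function.Embedding.subtype _)) hα hp hpq
      hαpq hb (fun R hR => by
        obtain ⟨R', -, rfl⟩ := Finset.mem_map.1 hR
        exact R'.2) hN
    rw [← hn, ← hcdef, Finset.sum_map] at key
    simp only [Function.Embedding.coe_subtype] at key
    have hσ0 : 0 ≤ ∑ R ∈ F', ‖haarCoeff b (R : DyadicRectangle d)‖ ^ 2 :=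
      Finset.sum_nonneg fun R _ => sq_nonneg _
    have e : ∑ R ∈ F', ‖haarCoeff b (R : DyadicRectangle d)‖ₑ ^ 2 =
        ENNReal.ofReal (∑ R ∈ F', ‖haarCoeff b (R : DyadicRectangle d)‖ ^ 2) := by
      rw [ENNReal.ofReal_sum_of_nonneg fun R _ => sq_nonneg _]
      exact Finset.sum_congr rfl fun R _ => by
        rw [ENNReal.ofReal_pow (norm_nonneg _), ofReal_norm]
    rw [e]
    refine ENNReal.ofReal_le_ofReal ?_
    rw [← Real.sqrt_eq_rpow, ← Real.sqrt_eq_rpow] at key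
    have h2 : √(∑ R ∈ F', ‖haarCoeff b (R : DyadicRectangle d)‖ ^ 2) ≤
        n / c * √(∏ j, (S j).length) := by
      rw [div_mul_eq_mul_div, le_div_iff₀ hc]
      linarith
    have h3 := pow_le_pow_left₀ (Real.sqrt_nonneg _) h2 2
    rw [mul_pow, Real.sq_sqrt hσ0, Real.sq_sqrt hV.le] at h3
    linarith
  have hV' : volume S.carrier = ENNReal.ofReal (∏ j, (S j).length) := S.volume_carrier
  calc _ ≤ ENNReal.ofReal c * ((ENNReal.ofReal (∏ j, (S j).length))⁻¹ *
        ENNReal.ofReal ((∏ j, (S j).length) * (n / c) ^ 2)) ^ (1 / 2 : ℝ) := by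
        rw [hV']
        gcongr
    _ = ENNReal.ofReal n := by
      rw [← ENNReal.ofReal_inv_of_pos hV, ← ENNReal.ofReal_mul (by positivity),
        inv_mul_cancel_left₀ hV.ne', ENNReal.ofReal_rpow_of_nonneg (by positivity) (by norm_num),
        ← Real.sqrt_eq_rpow, Real.sqrt_sq (by positivity), ← ENNReal.ofReal_mul hc.le,
        mul_div_cancel₀ _ hc.ne']
    _ = _ := ENNReal.ofReal_toReal hN

end

end DyadicRiesz

end

theorem proposition3p4 {𝕜 : Type*} [RCLike 𝕜] (d : ℕ) (hd : 1 ≤ d) (α p q : ℝ)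
    (hα₀ : 0 < α) (hα₁ : α < 1) (hp : 1 < p) (hpq : p < q)
    (hαpq : 1 - α + 1 / q = 1 / p) :
    ∃ c : ℝ≥0, 0 < c ∧
      ∀ b : (Fin d → ℝ) → 𝕜, LocallyIntegrable b volume →
        (c : ℝ≥0∞) * DyadicRiesz.rectBMO b ≤
          DyadicRiesz.opNorm (ENNReal.ofReal p) (ENNReal.ofReal q)
            (DyadicRiesz.iteratedComm α b) := by
  have hc : 0 < ((2 : ℝ) ^ (-α) / (1 - (2 : ℝ) ^ (-α))) ^ d :=
    pow_pos (div_pos (Real.rpow_pos_of_pos two_pos _)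
      (sub_pos.2 (Real.rpow_lt_one_of_one_lt_of_neg one_lt_two (by linarith)))) d
  exact ⟨_, Real.toNNReal_pos.2 hc, fun b hb =>
    DyadicRiesz.ofReal_mul_rectBMO_le hα₀ hp hpq hαpq hb⟩
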